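/- Let $\xi_1=p_1/r_1\in(0,1)$ be rational ($p_1,r_1\in\mathbb N$), let $q\in C^1[0,1]$ be real valued with $\int_0^1 q(x)\,dx=0$, and let $H,\gamma_1\in\mathbb R$, $\gamma_1\neq0$. Consider the problem $L=L(q,H,\gamma_1)$ (the case $h=\infty$) $$-y''+q(x)y=\lambda y,\quad 0<x<1,\qquad y(0)=0,\qquad y'(1)+Hy(1)-\gamma_1y(\xi_1)=0.$$ Let $S(x,\lambda)$ be the solution of the equation with $S(0,\lambda)=0$, $S'(0,\lambda)=1$, and let $\lambda_0,\lambda_1,\lambda_2,\dots$ be the eigenvalues of $L$, i.e. the zeros of $\Delta(\lambda)=S'(1,\lambda)+HS(1,\lambda)-\gamma_1S(\xi_1,\lambda)$, listed with their multiplicities as zeros of $\Delta$ and by nondecreasing modulus. Let $x_n^j$ be the $j$-th zero ($j=1,2,\dots$, from left to right) in $(0,1)$ of the eigenfunction $S(\cdot,\lambda_n)$, and let $X=\{x_n^j\}$ be the set of nodal points, each taken together with its indices $n,j$. Let $X_0\subset X$ be a dense set of nodal points, in the sense that every $x\in[0,1]$ is the limit, as $n\to\infty$, of some sequence $x_n^{j(n)}$,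 $n\ge n_0$, of elements of $X_0$. (a) Let $\widetilde L=L(\widetilde q,\widetilde H,\widetilde\gamma_1)$ be a second problem, with the same $\xi_1$ and under the same assumptions, and let $\widetilde X_0$ be a dense set of nodal points of $\widetilde L$ in the same sense. If $X_0=\widetilde X_0$ (as indexed sets), then $q=\widetilde q$ a.e. in $(0,1)$, $H=\widetilde H$ and $\gamma_1=\widetilde\gamma_1$. (b) For every $x\in[0,1]$ the limit $$g(x)=\lim_{m=2r_1n,\ n\to\infty}\left(m+\tfrac12\right)^2\pi^2\left(x_m^{j}-\frac{j}{m+\frac12}\right)$$ exists and is finite and the same for all sequences of points $x_m^{j}\in X_0$, $j=j(m)$, $m=2r_1n$, that converge to $x$; such sequences exist. The function $g$ is differentiable on $[0,1]$ (one-sidedly at the end points), and $$q(x)=2\left(g'(x)-g(1)\right)\quad(0\le x\le1),\qquad \gamma_1\sin\frac{\pi\xi_1}{2}-H=g(1).$$ -/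

import Mathlib

open Set Filter Topology MeasureTheory

namespace NonlocalSL

/-- `y` is a (twice differentiable) solution on `[0,1]` of `-y'' + q y = lam y`, with one-sided
derivatives at the end points. -/
structure IsSolution (q : ℝ → ℝ) (lam : ℂ) (y : ℝ → ℂ) : Prop where
  differentiableOn : DifferentiableOn ℝ y (Icc 0 1)
  hasDeriv : ∀ x ∈ Icc (0 : ℝ) 1,
    HasDerivWithinAt (derivWithin y (Icc 0 1)) (((q x : ℂ) - lam) * y x) (Icc 0 1) x

/-- `y` is a solution on `[0,1]` with the initial values `y(0) = 0`, `y'(0) = 1`. -/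
structure IsSineSolution (q : ℝ → ℝ) (lam : ℂ) (y : ℝ → ℂ) : Prop where
  isSolution : IsSolution q lam y
  zero : y 0 = 0
  deriv_zero : derivWithin y (Icc 0 1) 0 = 1

/-- The solution `S(·, lam)`. For continuous `q` it exists and is unique on `[0,1]`; its values
outside `[0,1]` are irrelevant and never used. -/
noncomputable def S (q : ℝ → ℝ) (lam : ℂ) : ℝ → ℂ :=
  Classical.epsilon (IsSineSolution q lam)

/-- The characteristic function of the problem
`-y'' + q y = lam y`, `y(0) = 0`, `y'(1) + H y(1) - γ y(ξ) = 0`.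
Since every solution with `y(0) = 0` is a multiple of `S(·, lam)`, its zeros are exactly the
eigenvalues, and `S(·, lam)` is then the eigenfunction up to a factor. -/
noncomputable def charFun (q : ℝ → ℝ) (H γ ξ : ℝ) (lam : ℂ) : ℂ :=
  derivWithin (S q lam) (Icc 0 1) 1 + H * S q lam 1 - γ * S q lam ξ

/-- `Λ 0, Λ 1, …` lists all eigenvalues (complex ones included), each as often as its
multiplicity as a zero of the characteristic function, by nondecreasing modulus. -/
structure IsEigenvalueSeq (q : ℝ → ℝ) (H γ ξ : ℝ) (Λ : ℕ → ℂ) : Prop where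
  norm_mono : Monotone fun n => ‖Λ n‖
  multiplicity : ∀ z : ℂ, {n : ℕ | Λ n = z}.encard = analyticOrderAt (charFun q H γ ξ) z

/-- The zeros in `(0,1)` of the eigenfunction for the eigenvalue `lam`. -/
def nodes (q : ℝ → ℝ) (lam : ℂ) : Set ℝ :=
  {x | x ∈ Ioo (0 : ℝ) 1 ∧ S q lam x = 0}

/-- The set of all nodal points, kept with their indices: `(n, j, x)` belongs to it iff
`x = x_n^j`, that is, iff `x` is the `j`-th zero in `(0,1)` (`j = 1, 2, …`, from left to right)
of the eigenfunction for `Λ n`. -/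
def nodalSet (q : ℝ → ℝ) (Λ : ℕ → ℂ) : Set (ℕ × ℕ × ℝ) :=
  {t | t.2.2 ∈ nodes q (Λ t.1) ∧ (nodes q (Λ t.1) ∩ Iic t.2.2).encard = (t.2.1 : ℕ∞)}

/-- Density of a set of indexed nodal points: every `x ∈ [0,1]` is the limit of a sequence
`x_n^{j(n)}`, `n ≥ n₀`, of points of the set. -/
def IsDenseNodalSet (X₀ : Set (ℕ × ℕ × ℝ)) : Prop :=
  ∀ x ∈ Icc (0 : ℝ) 1, ∃ (j : ℕ → ℕ) (y : ℕ → ℝ),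
    (∀ᶠ n in atTop, (n, j n, y n) ∈ X₀) ∧ Tendsto y atTop (𝓝 x)

/-- `y n = x_m^{j(n)}` with `m = 2 r n` is a sequence of points of `X₀` that converges to `x`. -/
def IsNodalSeq (X₀ : Set (ℕ × ℕ × ℝ)) (r : ℕ) (x : ℝ) (j : ℕ → ℕ) (y : ℕ → ℝ) : Prop :=
  (∀ᶠ n in atTop, (2 * r * n, j n, y n) ∈ X₀) ∧ Tendsto y atTop (𝓝 x)

/-- `a = lim (m + 1/2)² π² (x_m^j - j / (m + 1/2))`, where `m = 2 r n`, `n → ∞`, and `x_m^j` runs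
through points of `X₀` that converge to `x`: such sequences exist and all of them give `a`. -/
def IsNodalLimit (X₀ : Set (ℕ × ℕ × ℝ)) (r : ℕ) (x a : ℝ) : Prop :=
  (∃ j y, IsNodalSeq X₀ r x j y) ∧
  ∀ j y, IsNodalSeq X₀ r x j y →
    Tendsto (fun n : ℕ => (((2 * r * n : ℕ) : ℝ) + 1 / 2) ^ 2 * Real.pi ^ 2 *
      (y n - (j n : ℝ) / (((2 * r * n : ℕ) : ℝ) + 1 / 2))) atTop (𝓝 a)

end NonlocalSL

open NonlocalSL

namespace NonlocalSL

local notation "𝓔" => C(Icc (0 : ℝ) 1, ℂ)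

/-- The function on the line that extends `f` by constants. -/
noncomputable def ext01 (f : 𝓔) : ℝ → ℂ := IccExtend zero_le_one f

lemma continuous_ext01 (f : 𝓔) : Continuous (ext01 f) :=
  f.continuous.Icc_extend'

lemma ext01_of_mem (f : 𝓔) {x : ℝ} (hx : x ∈ Icc (0 : ℝ) 1) : ext01 f x = f ⟨x, hx⟩ :=
  IccExtend_of_mem _ _ hx

lemma norm_ext01_le (f : 𝓔) (x : ℝ) : ‖ext01 f x‖ ≤ ‖f‖ :=
  f.norm_coe_le_norm _

lemma hasDerivAt_integral_ext01 (f : 𝓔) (x : ℝ) :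
    HasDerivAt (fun u => ∫ t in (0 : ℝ)..u, ext01 f t) (ext01 f x) x :=
  intervalIntegral.integral_hasDerivAt_right ((continuous_ext01 f).intervalIntegrable _ _)
    ((continuous_ext01 f).stronglyMeasurableAtFilter _ _) (continuous_ext01 f).continuousAt

/-- Integration from `0` as an operator on continuous functions on `[0,1]`. -/
noncomputable def volterra : 𝓔 →L[ℂ] 𝓔 :=
  LinearMap.mkContinuous
    { toFun := fun f => ⟨fun x => ∫ t in (0 : ℝ)..x, ext01 f t,
        (continuous_iff_continuousAt.2 fun x =>
          (hasDerivAt_integral_ext01 f x).continuousAt).comp continuous_subtype_val⟩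
      map_add' := fun f g => by
        ext x
        simpa [ext01, IccExtend] using intervalIntegral.integral_add
          ((continuous_ext01 f).intervalIntegrable 0 (x : ℝ))
          ((continuous_ext01 g).intervalIntegrable 0 (x : ℝ))
      map_smul' := fun c f => by
        ext x
        simp [ext01, IccExtend] }
    1 (fun f => by
      rw [ContinuousMap.norm_le _ (by positivity)]
      intro x
      have h := intervalIntegral.norm_integral_le_of_norm_le_const (a := 0) (b := (x : ℝ))
        (f := ext01 f) (C := ‖f‖) (fun t _ => norm_ext01_le f t)
      have h1 : |(x : ℝ) - 0| ≤ 1 := by rw [sub_zero, abs_of_nonneg x.2.1]; exact x.2.2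
      calc _ ≤ ‖f‖ * |(x : ℝ) - 0| := h
        _ ≤ ‖f‖ * 1 := by gcongr
        _ = 1 * ‖f‖ := by ring)

lemma volterra_apply (f : 𝓔) (x : Icc (0 : ℝ) 1) :
    volterra f x = ∫ t in (0 : ℝ)..x, ext01 f t := rfl

lemma norm_volterra_le {f : 𝓔} {c : ℝ} {n : ℕ}
    (hf : ∀ x : Icc (0 : ℝ) 1, ‖f x‖ ≤ c * (x : ℝ) ^ n / n.factorial) (x : Icc (0 : ℝ) 1) :
    ‖volterra f x‖ ≤ c * (x : ℝ) ^ (n + 1) / (n + 1).factorial := by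
  rw [volterra_apply]
  have h := intervalIntegral.norm_integral_le_of_norm_le (μ := volume) (a := 0) (b := (x : ℝ))
    (f := ext01 f) (g := fun t => c / n.factorial * t ^ n) x.2.1
    (Eventually.of_forall fun t ht => by
      have ht' : t ∈ Icc (0 : ℝ) 1 := ⟨ht.1.le, ht.2.trans x.2.2⟩
      rw [ext01_of_mem f ht']
      refine (hf _).trans_eq ?_
      simp only; ring)
    ((by fun_prop : Continuous fun t : ℝ => c / n.factorial * t ^ n).intervalIntegrable _ _)
  refine h.trans_eq ?_
  rw [intervalIntegral.integral_const_mul, integral_pow, Nat.factorial_succ]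
  push_cast
  have : (n.factorial : ℝ) ≠ 0 := by positivity
  have : (n : ℝ) + 1 ≠ 0 := by positivity
  field_simp
  simp

/-- The operator `f ↦ ∫₀ˣ ∫₀ᵗ a f`. -/
noncomputable def volterraMul (a : 𝓔) : 𝓔 →L[ℂ] 𝓔 :=
  (volterra ∘L volterra) ∘L ContinuousLinearMap.mul ℂ 𝓔 a

lemma norm_volterraMul_pow_le (a f : 𝓔) (n : ℕ) (x : Icc (0 : ℝ) 1) :
    ‖(volterraMul a ^ n) f x‖ ≤ ‖a‖ ^ n * ‖f‖ * (x : ℝ) ^ (2 * n) / (2 * n).factorial := by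
  induction n generalizing x with
  | zero => simpa using f.norm_coe_le_norm x
  | succ n ih =>
    rw [pow_succ']
    change ‖volterra (volterra (a * (volterraMul a ^ n) f)) x‖ ≤ _
    have h1 : ∀ x : Icc (0 : ℝ) 1, ‖(a * (volterraMul a ^ n) f) x‖ ≤
        (‖a‖ ^ (n + 1) * ‖f‖) * (x : ℝ) ^ (2 * n) / (2 * n).factorial := by
      intro x
      rw [ContinuousMap.mul_apply, norm_mul]
      calc _ ≤ ‖a‖ * (‖a‖ ^ n * ‖f‖ * (x : ℝ) ^ (2 * n) / (2 * n).factorial) :=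
            mul_le_mul (a.norm_coe_le_norm x) (ih x) (norm_nonneg _) (norm_nonneg _)
        _ = _ := by ring
    exact norm_volterra_le (norm_volterra_le h1) x

lemma isUnit_one_sub_of_norm_pow_lt_one {R : Type*} [NormedRing R] [HasSummableGeomSeries R]
    {a : R} {n : ℕ} (h : ‖a ^ n‖ < 1) : IsUnit (1 - a) := by
  have hu : IsUnit (1 - a ^ n) := isUnit_one_sub_of_norm_lt_one h
  rw [← mul_neg_geom_sum] at hu
  have hc : Commute (1 - a) (∑ i ∈ Finset.range n, a ^ i) :=
    Commute.sum_right _ _ _ fun i _ =>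
      ((Commute.one_left _).sub_left (Commute.refl _)).pow_right i
  exact (hc.isUnit_mul_iff.1 hu).1

lemma differentiable_inverse_one_sub {R : Type*} [NormedRing R] [HasSummableGeomSeries R]
    [NormedAlgebra ℂ R] {F : ℂ → R} (hF : Differentiable ℂ F) (hu : ∀ z, IsUnit (1 - F z)) :
    Differentiable ℂ fun z => Ring.inverse (1 - F z) :=
  ((differentiable_const _).sub hF).inverse hu

lemma isUnit_one_sub_volterraMul (a : 𝓔) : IsUnit (1 - volterraMul a) := by
  have hlim : Tendsto (fun n : ℕ => ‖a‖ ^ n / n.factorial) atTop (𝓝 0) :=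
    FloorSemiring.tendsto_pow_div_factorial_atTop ‖a‖
  obtain ⟨n, hn⟩ := (hlim.eventually (gt_mem_nhds (zero_lt_one' ℝ))).exists
  have hnorm : ‖volterraMul a ^ n‖ < 1 := by
    refine lt_of_le_of_lt (ContinuousLinearMap.opNorm_le_bound _ (by positivity) fun f => ?_) hn
    rw [ContinuousMap.norm_le _ (by positivity)]
    intro x
    refine (norm_volterraMul_pow_le a f n x).trans ?_
    have h1 : (x : ℝ) ^ (2 * n) ≤ 1 := pow_le_one₀ x.2.1 x.2.2
    have h2 : (n.factorial : ℝ) ≤ (2 * n).factorial := by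
      exact_mod_cast Nat.factorial_le (by omega)
    have h3 : (0 : ℝ) < n.factorial := by positivity
    calc _ ≤ ‖a‖ ^ n * ‖f‖ * 1 / n.factorial := by gcongr
      _ = _ := by ring
  exact isUnit_one_sub_of_norm_pow_lt_one (R := 𝓔 →L[ℂ] 𝓔) hnorm

/-- The coefficient `q - lam` on `[0,1]`. -/
noncomputable def coeff (Q : 𝓔) (lam : ℂ) : 𝓔 := Q - algebraMap ℂ 𝓔 lam

lemma coeff_apply (Q : 𝓔) (lam : ℂ) (x : Icc (0 : ℝ) 1) : coeff Q lam x = Q x - lam := by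
  simp [coeff]

/-- The coordinate function of `[0,1]`. -/
noncomputable def coord : 𝓔 := ⟨fun x => ((x : ℝ) : ℂ), by fun_prop⟩

/-- The solution with `y(0) = 0`, `y'(0) = 1`, as an element of `C[0,1]`. -/
noncomputable def sineSol (Q : 𝓔) (lam : ℂ) : 𝓔 :=
  Ring.inverse (1 - volterraMul (coeff Q lam)) coord

lemma sineSol_eq (Q : 𝓔) (lam : ℂ) :
    sineSol Q lam = coord + volterra (volterra (coeff Q lam * sineSol Q lam)) := by
  have h := Ring.mul_inverse_cancel _ (isUnit_one_sub_volterraMul (coeff Q lam))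
  have h2 := congrArg (fun T : 𝓔 →L[ℂ] 𝓔 => T coord) h
  change sineSol Q lam - volterra (volterra (coeff Q lam * sineSol Q lam)) = coord at h2
  rw [← h2]; abel

lemma eq_sineSol {Q f : 𝓔} {lam : ℂ}
    (hf : f = coord + volterra (volterra (coeff Q lam * f))) : f = sineSol Q lam := by
  have h := Ring.inverse_mul_cancel _ (isUnit_one_sub_volterraMul (coeff Q lam))
  have h2 := congrArg (fun T : 𝓔 →L[ℂ] 𝓔 => T f) h
  have h3 : (1 - volterraMul (coeff Q lam)) f = coord := by
    change f - volterra (volterra (coeff Q lam * f)) = coord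
    nth_rewrite 1 [hf]; abel
  change Ring.inverse (1 - volterraMul (coeff Q lam))
    ((1 - volterraMul (coeff Q lam)) f) = f at h2
  rw [h3] at h2
  exact h2.symm

lemma differentiable_coeff (Q : 𝓔) : Differentiable ℂ (coeff Q) := by
  have : coeff Q = fun lam => Q - Algebra.linearMap ℂ 𝓔 lam := rfl
  rw [this]
  exact (differentiable_const _).sub
    (LinearMap.toContinuousLinearMap (Algebra.linearMap ℂ 𝓔)).differentiable

lemma differentiable_volterraMul_coeff (Q : 𝓔) :
    Differentiable ℂ fun lam => volterraMul (coeff Q lam) := fun lam =>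
  DifferentiableAt.comp (𝕜 := ℂ)
    (g := ContinuousLinearMap.compL ℂ 𝓔 𝓔 𝓔 (volterra ∘L volterra)) lam
    (ContinuousLinearMap.differentiableAt _)
    ((ContinuousLinearMap.differentiableAt _).comp _ (differentiable_coeff Q lam))

lemma differentiable_inverse_one_sub_volterraMul (Q : 𝓔) :
    Differentiable ℂ fun lam => Ring.inverse (1 - volterraMul (coeff Q lam)) :=
  differentiable_inverse_one_sub (R := 𝓔 →L[ℂ] 𝓔) (F := fun lam => volterraMul (coeff Q lam))
    (differentiable_volterraMul_coeff Q) (fun l => isUnit_one_sub_volterraMul (coeff Q l))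

lemma differentiable_sineSol (Q : 𝓔) : Differentiable ℂ (sineSol Q) := fun lam =>
  DifferentiableAt.comp (𝕜 := ℂ) (g := ContinuousLinearMap.apply ℂ 𝓔 coord)
    (f := fun lam => Ring.inverse (1 - volterraMul (coeff Q lam))) lam
    (ContinuousLinearMap.differentiableAt _) (differentiable_inverse_one_sub_volterraMul Q lam)

/-- The derivative of `sineSol`, as an element of `C[0,1]`. -/
noncomputable def sineSolDeriv (Q : 𝓔) (lam : ℂ) : 𝓔 :=
  1 + volterra (coeff Q lam * sineSol Q lam)

lemma differentiable_sineSolDeriv (Q : 𝓔) : Differentiable ℂ (sineSolDeriv Q) := by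
  intro lam
  refine (differentiableAt_const _).add ?_
  exact (ContinuousLinearMap.differentiableAt _).comp _
    ((differentiable_coeff Q lam).mul (differentiable_sineSol Q lam))

lemma differentiable_eval {F : ℂ → 𝓔} (hF : Differentiable ℂ F) (x : Icc (0 : ℝ) 1) :
    Differentiable ℂ fun lam => F lam x := fun lam =>
  DifferentiableAt.comp (g := fun f : 𝓔 => f x) lam
    (ContinuousMap.evalCLM ℂ x : 𝓔 →L[ℂ] ℂ).differentiableAt (hF lam)

/-- A potential that is continuous on `[0,1]`, as an element of `C[0,1]`. -/
noncomputable def potential {q : ℝ → ℝ} (hq : ContinuousOn q (Icc 0 1)) : 𝓔 :=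
  ⟨fun x => (q x : ℂ), Complex.continuous_ofReal.comp (continuousOn_iff_continuous_domRestrict.1 hq)⟩

lemma uniqueDiffWithinAt_Icc01 {x : ℝ} (hx : x ∈ Icc (0 : ℝ) 1) :
    UniqueDiffWithinAt ℝ (Icc (0 : ℝ) 1) x := uniqueDiffOn_Icc zero_lt_one x hx

variable {q : ℝ → ℝ}

lemma ext01_sineSol_eq (Q : 𝓔) (lam : ℂ) {x : ℝ} (hx : x ∈ Icc (0 : ℝ) 1) :
    ext01 (sineSol Q lam) x = x + ∫ t in (0 : ℝ)..x, ext01 (volterra (coeff Q lam * sineSol Q lam)) t := by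
  rw [ext01_of_mem _ hx]
  nth_rewrite 1 [sineSol_eq]
  rfl

lemma hasDerivWithinAt_ext01_sineSol (Q : 𝓔) (lam : ℂ) {x : ℝ} (hx : x ∈ Icc (0 : ℝ) 1) :
    HasDerivWithinAt (ext01 (sineSol Q lam)) (ext01 (sineSolDeriv Q lam) x) (Icc 0 1) x := by
  have h : HasDerivAt (fun x : ℝ => (x : ℂ) +
      ∫ t in (0 : ℝ)..x, ext01 (volterra (coeff Q lam * sineSol Q lam)) t)
      (ext01 (sineSolDeriv Q lam) x) x :=
    (Complex.ofRealCLM.hasDerivAt (x := x)).add (hasDerivAt_integral_ext01 _ x)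
  exact h.hasDerivWithinAt.congr (fun y hy => ext01_sineSol_eq Q lam hy) (ext01_sineSol_eq Q lam hx)

lemma hasDerivWithinAt_ext01_sineSolDeriv (Q : 𝓔) (lam : ℂ) {x : ℝ} (hx : x ∈ Icc (0 : ℝ) 1) :
    HasDerivWithinAt (ext01 (sineSolDeriv Q lam))
      ((Q ⟨x, hx⟩ - lam) * ext01 (sineSol Q lam) x) (Icc 0 1) x := by
  have h : HasDerivAt (fun x : ℝ => 1 + ∫ t in (0 : ℝ)..x, ext01 (coeff Q lam * sineSol Q lam) t)
      (ext01 (coeff Q lam * sineSol Q lam) x) x :=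
    (hasDerivAt_integral_ext01 _ x).const_add 1
  rw [ext01_of_mem _ hx, ContinuousMap.mul_apply, coeff_apply] at h
  rw [ext01_of_mem _ hx]
  exact h.hasDerivWithinAt.congr (fun y hy => ext01_of_mem _ hy) (ext01_of_mem _ hx)

lemma isSineSolution_ext01_sineSol (hq : ContinuousOn q (Icc 0 1)) (lam : ℂ) :
    IsSineSolution q lam (ext01 (sineSol (potential hq) lam)) := by
  have hd : ∀ x ∈ Icc (0 : ℝ) 1, derivWithin (ext01 (sineSol (potential hq) lam)) (Icc 0 1) x =
      ext01 (sineSolDeriv (potential hq) lam) x := fun x hx =>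
    (hasDerivWithinAt_ext01_sineSol _ lam hx).derivWithin (uniqueDiffWithinAt_Icc01 hx)
  refine ⟨⟨fun x hx => (hasDerivWithinAt_ext01_sineSol _ lam hx).differentiableWithinAt,
    fun x hx => ?_⟩, ?_, ?_⟩
  · exact (hasDerivWithinAt_ext01_sineSolDeriv (potential hq) lam hx).congr hd (hd x hx)
  · rw [ext01_sineSol_eq _ _ (left_mem_Icc.2 zero_le_one)]; simp
  · rw [hd 0 (left_mem_Icc.2 zero_le_one), ext01_of_mem _ (left_mem_Icc.2 zero_le_one)]
    simp [sineSolDeriv, volterra_apply]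

lemma eq_add_integral_of_hasDerivWithinAt {f f' : ℝ → ℂ} {F' : 𝓔}
    (hf : ∀ x ∈ Icc (0 : ℝ) 1, HasDerivWithinAt f (f' x) (Icc 0 1) x)
    (hF : ∀ x ∈ Icc (0 : ℝ) 1, f' x = ext01 F' x) {x : ℝ} (hx : x ∈ Icc (0 : ℝ) 1) :
    f x = f 0 + ∫ t in (0 : ℝ)..x, ext01 F' t := by
  have h := intervalIntegral.integral_eq_sub_of_hasDeriv_right_of_le (f := f) (f' := ext01 F') hx.1
    (fun y hy => ((hf y ⟨hy.1, hy.2.trans hx.2⟩).continuousWithinAt).mono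
      (Icc_subset_Icc_right hx.2))
    (fun y hy => by
      have hy' : y ∈ Icc (0 : ℝ) 1 := ⟨hy.1.le, hy.2.le.trans hx.2⟩
      have h1 := hf y hy'
      rw [hF y hy'] at h1
      exact (h1.hasDerivAt (Icc_mem_nhds hy.1 (hy.2.trans_le hx.2))).hasDerivWithinAt)
    ((continuous_ext01 F').intervalIntegrable _ _)
  rw [h]; ring

lemma IsSineSolution.eqOn (hq : ContinuousOn q (Icc 0 1)) {lam : ℂ} {y : ℝ → ℂ}
    (hy : IsSineSolution q lam y) :
    EqOn y (ext01 (sineSol (potential hq) lam)) (Icc 0 1) := by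
  set f : 𝓔 := ⟨fun x => y x, continuousOn_iff_continuous_domRestrict.1
    hy.isSolution.differentiableOn.continuousOn⟩ with hf
  have h1 : ∀ x ∈ Icc (0 : ℝ) 1, derivWithin y (Icc 0 1) x =
      ext01 (1 + volterra (coeff (potential hq) lam * f)) x := fun x hx => by
    rw [eq_add_integral_of_hasDerivWithinAt (F' := coeff (potential hq) lam * f)
      hy.isSolution.hasDeriv (fun t ht => ?_) hx, hy.deriv_zero, ext01_of_mem _ hx]
    · rfl
    · rw [ext01_of_mem _ ht, ContinuousMap.mul_apply, coeff_apply]; rfl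
  have h2 : f = coord + volterra (volterra (coeff (potential hq) lam * f)) := by
    ext x
    have h3 := eq_add_integral_of_hasDerivWithinAt (f := y)
      (F' := 1 + volterra (coeff (potential hq) lam * f))
      (fun t ht => (hy.isSolution.differentiableOn t ht).hasDerivWithinAt) h1 x.2
    rw [hy.zero, zero_add] at h3
    change y x = _
    rw [h3]
    change volterra (1 + volterra (coeff (potential hq) lam * f)) x = _
    rw [map_add, ContinuousMap.add_apply, ContinuousMap.add_apply]
    congr 1
    rw [volterra_apply]
    simp [ext01, IccExtend, coord]
  intro x hx
  rw [ext01_of_mem _ hx, ← eq_sineSol h2]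
  rfl

lemma isSineSolution_S (hq : ContinuousOn q (Icc 0 1)) (lam : ℂ) :
    IsSineSolution q lam (S q lam) :=
  Classical.epsilon_spec ⟨_, isSineSolution_ext01_sineSol hq lam⟩

lemma IsSineSolution.eqOn_S (hq : ContinuousOn q (Icc 0 1)) {lam : ℂ} {y : ℝ → ℂ}
    (hy : IsSineSolution q lam y) : EqOn y (S q lam) (Icc 0 1) :=
  (hy.eqOn hq).trans ((isSineSolution_S hq lam).eqOn hq).symm

lemma derivWithin_S_eq (hq : ContinuousOn q (Icc 0 1)) (lam : ℂ) {x : ℝ}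
    (hx : x ∈ Icc (0 : ℝ) 1) :
    derivWithin (S q lam) (Icc 0 1) x = ext01 (sineSolDeriv (potential hq) lam) x := by
  have h := (isSineSolution_S hq lam).eqOn hq
  rw [derivWithin_congr h (h hx)]
  exact (hasDerivWithinAt_ext01_sineSol _ lam hx).derivWithin (uniqueDiffWithinAt_Icc01 hx)

lemma differentiable_charFun (hq : ContinuousOn q (Icc 0 1)) (H γ : ℝ) {ξ : ℝ}
    (hξ : ξ ∈ Icc (0 : ℝ) 1) : Differentiable ℂ (charFun q H γ ξ) := by
  have h1 : (1 : ℝ) ∈ Icc (0 : ℝ) 1 := right_mem_Icc.2 zero_le_one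
  have : charFun q H γ ξ = fun lam => sineSolDeriv (potential hq) lam ⟨1, h1⟩ +
      H * sineSol (potential hq) lam ⟨1, h1⟩ - γ * sineSol (potential hq) lam ⟨ξ, hξ⟩ := by
    ext lam
    have h := (isSineSolution_S hq lam).eqOn hq
    rw [charFun, derivWithin_S_eq hq lam h1, h h1, h hξ, ext01_of_mem _ h1, ext01_of_mem _ h1,
      ext01_of_mem _ hξ]
  rw [this]
  exact ((differentiable_eval (differentiable_sineSolDeriv _) _).add
    ((differentiable_eval (differentiable_sineSol _) _).const_mul _)).sub
    ((differentiable_eval (differentiable_sineSol _) _).const_mul _)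

lemma IsSineSolution.conj {lam : ℝ} {y : ℝ → ℂ} (hy : IsSineSolution q lam y) :
    IsSineSolution q lam (fun x => (starRingEnd ℂ) (y x)) := by
  have hd : ∀ x ∈ Icc (0 : ℝ) 1, HasDerivWithinAt (fun x => (starRingEnd ℂ) (y x))
      ((starRingEnd ℂ) (derivWithin y (Icc 0 1) x)) (Icc 0 1) x := fun x hx =>
    Complex.conjCLE.toContinuousLinearMap.hasFDerivAt.comp_hasDerivWithinAt x
      (hy.isSolution.differentiableOn x hx).hasDerivWithinAt
  have hd' : ∀ x ∈ Icc (0 : ℝ) 1, derivWithin (fun x => (starRingEnd ℂ) (y x)) (Icc 0 1) x =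
      (starRingEnd ℂ) (derivWithin y (Icc 0 1) x) := fun x hx =>
    (hd x hx).derivWithin (uniqueDiffWithinAt_Icc01 hx)
  refine ⟨⟨fun x hx => (hd x hx).differentiableWithinAt, fun x hx => ?_⟩, ?_, ?_⟩
  · have h : HasDerivWithinAt (fun x => (starRingEnd ℂ) (derivWithin y (Icc 0 1) x))
        ((starRingEnd ℂ) (((q x : ℂ) - lam) * y x)) (Icc 0 1) x :=
      Complex.conjCLE.toContinuousLinearMap.hasFDerivAt.comp_hasDerivWithinAt x
        (hy.isSolution.hasDeriv x hx)
    simp only [map_mul, map_sub, Complex.conj_ofReal] at h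
    exact h.congr hd' (hd' x hx)
  · simp [hy.zero]
  · rw [hd' 0 (left_mem_Icc.2 zero_le_one), hy.deriv_zero, map_one]

lemma im_S_ofReal (hq : ContinuousOn q (Icc 0 1)) (lam : ℝ) {x : ℝ} (hx : x ∈ Icc (0 : ℝ) 1) :
    (S q lam x).im = 0 :=
  Complex.conj_eq_iff_im.1 ((isSineSolution_S hq lam).conj.eqOn_S hq hx)

lemma im_derivWithin_S_ofReal (hq : ContinuousOn q (Icc 0 1)) (lam : ℝ) {x : ℝ}
    (hx : x ∈ Icc (0 : ℝ) 1) : (derivWithin (S q lam) (Icc 0 1) x).im = 0 := by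
  have h := (isSineSolution_S hq lam).isSolution.differentiableOn x hx
  have h1 : HasDerivWithinAt (fun x => (S q lam x).im)
      (derivWithin (S q lam) (Icc 0 1) x).im (Icc 0 1) x :=
    Complex.imCLM.hasFDerivAt.comp_hasDerivWithinAt x h.hasDerivWithinAt
  have h2 : HasDerivWithinAt (fun x => (S q lam x).im) 0 (Icc 0 1) x :=
    (hasDerivWithinAt_const x _ (0 : ℝ)).congr (fun t ht => im_S_ofReal hq lam ht)
      (im_S_ofReal hq lam hx)
  exact (uniqueDiffWithinAt_Icc01 hx).eq_deriv _ h1 h2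

/-- The amplitude of `S' + σ S` relative to `exp (σ x)`, where `S` belongs to `lam = -σ²`. -/
noncomputable def amplitude (q : ℝ → ℝ) (σ : ℂ) (x : ℝ) : ℂ :=
  (derivWithin (S q (-σ ^ 2)) (Icc 0 1) x + σ * S q (-σ ^ 2) x) * Complex.exp (-(σ * x))

lemma amplitude_mul_exp (q : ℝ → ℝ) (σ : ℂ) (x : ℝ) :
    amplitude q σ x * Complex.exp (σ * x) =
      derivWithin (S q (-σ ^ 2)) (Icc 0 1) x + σ * S q (-σ ^ 2) x := by
  rw [amplitude, mul_assoc, ← Complex.exp_add]; simp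

lemma amplitude_zero (hq : ContinuousOn q (Icc 0 1)) (σ : ℂ) : amplitude q σ 0 = 1 := by
  have h := isSineSolution_S hq (-σ ^ 2)
  simp [amplitude, h.zero, h.deriv_zero]

lemma hasDerivWithinAt_amplitude (hq : ContinuousOn q (Icc 0 1)) (σ : ℂ) {x : ℝ}
    (hx : x ∈ Icc (0 : ℝ) 1) :
    HasDerivWithinAt (amplitude q σ) (Complex.exp (-(σ * x)) * (q x * S q (-σ ^ 2) x))
      (Icc 0 1) x := by
  have h := (isSineSolution_S hq (-σ ^ 2)).isSolution
  have h1 := (h.differentiableOn x hx).hasDerivWithinAt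
  have h2 := h.hasDeriv x hx
  have h3 : HasDerivAt (fun x : ℝ => Complex.exp (-(σ * x)))
      (Complex.exp (-(σ * x)) * (-(σ * 1))) x :=
    (((Complex.ofRealCLM.hasDerivAt (x := x)).const_mul σ).neg).cexp
  refine ((h2.add (h1.const_mul σ)).mul h3.hasDerivWithinAt).congr_deriv ?_
  simp only [Pi.add_apply]
  ring

lemma norm_amplitude_sub_one_le (hq : ContinuousOn q (Icc 0 1)) {K M : ℝ} (hM : 0 ≤ M)
    (hK : ∀ x ∈ Icc (0 : ℝ) 1, |q x| ≤ K) (σ : ℂ)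
    (hS : ∀ x ∈ Icc (0 : ℝ) 1, ‖S q (-σ ^ 2) x‖ ≤ M * Real.exp (|σ.re| * x))
    {x : ℝ} (hx : x ∈ Icc (0 : ℝ) 1) :
    ‖amplitude q σ x - 1‖ ≤ K * M * Real.exp ((|σ.re| - σ.re) * x) := by
  have hK0 : 0 ≤ K := (abs_nonneg _).trans (hK x hx)
  have hsub : Icc 0 x ⊆ Icc (0 : ℝ) 1 := Icc_subset_Icc_right hx.2
  have h := (convex_Icc 0 x).norm_image_sub_le_of_norm_hasDerivWithin_le
    (f := amplitude q σ) (C := K * M * Real.exp ((|σ.re| - σ.re) * x))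
    (fun t ht => (hasDerivWithinAt_amplitude hq σ (hsub ht)).mono hsub)
    (fun t ht => by
      have ht1 := hsub ht
      rw [norm_mul, norm_mul, Complex.norm_exp, Complex.norm_real, Real.norm_eq_abs]
      have e : (-(σ * (t : ℂ))).re = -σ.re * t := by simp
      rw [e]
      calc Real.exp (-σ.re * t) * (|q t| * ‖S q (-σ ^ 2) t‖)
          ≤ Real.exp (-σ.re * t) * (K * (M * Real.exp (|σ.re| * t))) := by
            gcongr
            · exact hK t ht1
            · exact hS t ht1
        _ = K * M * Real.exp ((|σ.re| - σ.re) * t) := by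
            rw [sub_mul, sub_eq_add_neg, Real.exp_add]; ring_nf
        _ ≤ _ := by
            have : 0 ≤ |σ.re| - σ.re := sub_nonneg.2 (le_abs_self _)
            gcongr
            exact ht.2)
    (left_mem_Icc.2 hx.1) (right_mem_Icc.2 hx.1)
  rw [amplitude_zero hq] at h
  refine h.trans ?_
  rw [sub_zero, Real.norm_eq_abs, abs_of_nonneg hx.1]
  exact mul_le_of_le_one_right (by positivity) hx.2

lemma norm_deriv_add_mul_S_sub_exp_le (hq : ContinuousOn q (Icc 0 1)) {K M : ℝ} (hM : 0 ≤ M)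
    (hK : ∀ x ∈ Icc (0 : ℝ) 1, |q x| ≤ K) (σ : ℂ)
    (hS : ∀ x ∈ Icc (0 : ℝ) 1, ‖S q (-σ ^ 2) x‖ ≤ M * Real.exp (|σ.re| * x))
    {x : ℝ} (hx : x ∈ Icc (0 : ℝ) 1) :
    ‖derivWithin (S q (-σ ^ 2)) (Icc 0 1) x + σ * S q (-σ ^ 2) x - Complex.exp (σ * x)‖ ≤
      K * M * Real.exp (|σ.re| * x) := by
  have h := norm_amplitude_sub_one_le hq hM hK σ hS hx
  rw [← amplitude_mul_exp, ← sub_one_mul, norm_mul, Complex.norm_exp]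
  have e : (σ * (x : ℂ)).re = σ.re * x := by simp
  rw [e]
  calc _ ≤ K * M * Real.exp ((|σ.re| - σ.re) * x) * Real.exp (σ.re * x) := by gcongr
    _ = _ := by rw [mul_assoc, ← Real.exp_add]; ring_nf

lemma sq_I_mul (ρ : ℂ) : -(Complex.I * ρ) ^ 2 = ρ ^ 2 := by
  rw [mul_pow, Complex.I_sq]; ring

lemma sq_neg_I_mul (ρ : ℂ) : -(-(Complex.I * ρ)) ^ 2 = ρ ^ 2 := by
  rw [neg_sq, sq_I_mul]

lemma norm_deriv_S_sub_cos_and_norm_S_sub_sin_le (hq : ContinuousOn q (Icc 0 1)) {K M : ℝ}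
    (hM : 0 ≤ M) (hK : ∀ x ∈ Icc (0 : ℝ) 1, |q x| ≤ K) (ρ : ℂ)
    (hS : ∀ x ∈ Icc (0 : ℝ) 1, ‖S q (ρ ^ 2) x‖ ≤ M * Real.exp (|ρ.im| * x))
    {x : ℝ} (hx : x ∈ Icc (0 : ℝ) 1) :
    ‖derivWithin (S q (ρ ^ 2)) (Icc 0 1) x - Complex.cos (ρ * x)‖ ≤
      K * M * Real.exp (|ρ.im| * x) ∧
    ‖ρ * S q (ρ ^ 2) x - Complex.sin (ρ * x)‖ ≤ K * M * Real.exp (|ρ.im| * x) := by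
  have h1 := norm_deriv_add_mul_S_sub_exp_le hq hM hK (Complex.I * ρ)
    (fun t ht => by
      rw [sq_I_mul]; simpa using hS t ht) hx
  have h2 := norm_deriv_add_mul_S_sub_exp_le hq hM hK (-(Complex.I * ρ))
    (fun t ht => by
      rw [sq_neg_I_mul]; simpa using hS t ht) hx
  rw [sq_I_mul] at h1
  rw [sq_neg_I_mul] at h2
  have e1 : |(Complex.I * ρ).re| = |ρ.im| := by simp
  have e2 : |(-(Complex.I * ρ)).re| = |ρ.im| := by simp
  rw [e1] at h1
  rw [e2] at h2
  have e3 : Complex.exp (Complex.I * ρ * x) = Complex.cos (ρ * x) + Complex.sin (ρ * x) * Complex.I := by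
    rw [← Complex.exp_mul_I]; ring_nf
  have e4 : Complex.exp (-(Complex.I * ρ) * x) =
      Complex.cos (ρ * x) - Complex.sin (ρ * x) * Complex.I := by
    have := Complex.exp_mul_I (-(ρ * x))
    rw [Complex.cos_neg, Complex.sin_neg] at this
    rw [sub_eq_add_neg, ← neg_mul (Complex.sin _), ← this]; ring_nf
  rw [e3] at h1
  rw [e4] at h2
  set D := derivWithin (S q (ρ ^ 2)) (Icc 0 1) x
  set Y := S q (ρ ^ 2) x
  set B := K * M * Real.exp (|ρ.im| * x)
  constructor
  · have e : D - Complex.cos (ρ * x) =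
        ((D + Complex.I * ρ * Y - (Complex.cos (ρ * x) + Complex.sin (ρ * x) * Complex.I)) +
        (D + -(Complex.I * ρ) * Y - (Complex.cos (ρ * x) - Complex.sin (ρ * x) * Complex.I))) / 2 := by
      ring
    rw [e, norm_div, Complex.norm_two]
    linarith [norm_add_le
      (D + Complex.I * ρ * Y - (Complex.cos (ρ * x) + Complex.sin (ρ * x) * Complex.I))
      (D + -(Complex.I * ρ) * Y - (Complex.cos (ρ * x) - Complex.sin (ρ * x) * Complex.I))]
  · have e : Complex.I * (ρ * Y - Complex.sin (ρ * x)) =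
        ((D + Complex.I * ρ * Y - (Complex.cos (ρ * x) + Complex.sin (ρ * x) * Complex.I)) -
        (D + -(Complex.I * ρ) * Y - (Complex.cos (ρ * x) - Complex.sin (ρ * x) * Complex.I))) / 2 := by
      ring
    have e' : ‖ρ * Y - Complex.sin (ρ * x)‖ = ‖Complex.I * (ρ * Y - Complex.sin (ρ * x))‖ := by
      simp
    rw [e', e, norm_div, Complex.norm_two]
    linarith [norm_sub_le
      (D + Complex.I * ρ * Y - (Complex.cos (ρ * x) + Complex.sin (ρ * x) * Complex.I))
      (D + -(Complex.I * ρ) * Y - (Complex.cos (ρ * x) - Complex.sin (ρ * x) * Complex.I))]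

lemma norm_sin_le_exp (z : ℂ) : ‖Complex.sin z‖ ≤ Real.exp |z.im| := by
  have h1 : ‖Complex.exp (-z * Complex.I)‖ ≤ Real.exp |z.im| := by
    rw [Complex.norm_exp]; simpa using le_abs_self _
  have h2 : ‖Complex.exp (z * Complex.I)‖ ≤ Real.exp |z.im| := by
    rw [Complex.norm_exp]; simpa using neg_le_abs _
  rw [Complex.sin, norm_div, norm_mul, Complex.norm_I, Complex.norm_two]
  linarith [norm_sub_le (Complex.exp (-z * Complex.I)) (Complex.exp (z * Complex.I))]

lemma norm_S_le (hq : ContinuousOn q (Icc 0 1)) {K : ℝ}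
    (hK : ∀ x ∈ Icc (0 : ℝ) 1, |q x| ≤ K) {ρ : ℂ} (hρ0 : ρ ≠ 0) (hρ : 2 * K ≤ ‖ρ‖)
    {x : ℝ} (hx : x ∈ Icc (0 : ℝ) 1) :
    ‖S q (ρ ^ 2) x‖ ≤ 2 / ‖ρ‖ * Real.exp (|ρ.im| * x) := by
  have hcont : ContinuousOn (fun x => ‖S q (ρ ^ 2) x‖ * Real.exp (-(|ρ.im| * x))) (Icc 0 1) :=
    ((isSineSolution_S hq _).isSolution.differentiableOn.continuousOn.norm).mul (by fun_prop)
  obtain ⟨z, hz, hmax⟩ := isCompact_Icc.exists_isMaxOn (nonempty_Icc.2 zero_le_one) hcont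
  set M := ‖S q (ρ ^ 2) z‖ * Real.exp (-(|ρ.im| * z)) with hMdef
  have hM : 0 ≤ M := by positivity
  have hS : ∀ x ∈ Icc (0 : ℝ) 1, ‖S q (ρ ^ 2) x‖ ≤ M * Real.exp (|ρ.im| * x) := fun x hx => by
    have h := hmax hx
    simp only [mem_ofPred_eq] at h
    rw [Real.exp_neg, ← div_eq_mul_inv, div_le_iff₀ (Real.exp_pos _)] at h
    exact h
  have hρ' : 0 < ‖ρ‖ := norm_pos_iff.2 hρ0
  have h2 := (norm_deriv_S_sub_cos_and_norm_S_sub_sin_le hq hM hK ρ hS hz).2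
  have h3 := norm_sin_le_exp (ρ * z)
  have e : |(ρ * (z : ℂ)).im| = |ρ.im| * z := by
    simp [abs_mul, abs_of_nonneg hz.1]
  rw [e] at h3
  have h4 : ‖ρ‖ * ‖S q (ρ ^ 2) z‖ ≤ (1 + K * M) * Real.exp (|ρ.im| * z) := by
    rw [← norm_mul]
    calc _ = ‖(ρ * S q (ρ ^ 2) z - Complex.sin (ρ * z)) + Complex.sin (ρ * z)‖ := by ring_nf
      _ ≤ _ := (norm_add_le _ _).trans (by linarith)
  have h5 : ‖ρ‖ * M ≤ 1 + K * M := by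
    rw [hMdef, ← mul_assoc, Real.exp_neg, ← div_eq_mul_inv, div_le_iff₀ (Real.exp_pos _)]
    rwa [hMdef, Real.exp_neg] at h4
  have h6 : M ≤ 2 / ‖ρ‖ := by
    rw [le_div_iff₀ hρ']
    nlinarith
  exact (hS x hx).trans (by gcongr)

lemma norm_deriv_S_sub_cos_le (hq : ContinuousOn q (Icc 0 1)) {K : ℝ}
    (hK : ∀ x ∈ Icc (0 : ℝ) 1, |q x| ≤ K) {ρ : ℂ} (hρ0 : ρ ≠ 0) (hρ : 2 * K ≤ ‖ρ‖)
    {x : ℝ} (hx : x ∈ Icc (0 : ℝ) 1) :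
    ‖derivWithin (S q (ρ ^ 2)) (Icc 0 1) x - Complex.cos (ρ * x)‖ ≤
      K * (2 / ‖ρ‖) * Real.exp (|ρ.im| * x) :=
  (norm_deriv_S_sub_cos_and_norm_S_sub_sin_le hq (by positivity) hK ρ
    (fun _ ht => norm_S_le hq hK hρ0 hρ ht) hx).1

lemma norm_charFun_sub_cos_le (hq : ContinuousOn q (Icc 0 1)) {K : ℝ}
    (hK : ∀ x ∈ Icc (0 : ℝ) 1, |q x| ≤ K) (H γ : ℝ) {ξ : ℝ} (hξ : ξ ∈ Icc (0 : ℝ) 1)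
    {ρ : ℂ} (hρ0 : ρ ≠ 0) (hρ : 2 * K ≤ ‖ρ‖) :
    ‖charFun q H γ ξ (ρ ^ 2) - Complex.cos ρ‖ ≤
      (K + |H| + |γ|) * (2 / ‖ρ‖) * Real.exp |ρ.im| := by
  have h1 : (1 : ℝ) ∈ Icc (0 : ℝ) 1 := right_mem_Icc.2 zero_le_one
  have hD := norm_deriv_S_sub_cos_le hq hK hρ0 hρ h1
  have hS1 := norm_S_le hq hK hρ0 hρ h1
  have hSξ := norm_S_le hq hK hρ0 hρ hξ
  have hexp : Real.exp (|ρ.im| * ξ) ≤ Real.exp |ρ.im| :=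
    Real.exp_le_exp.2 (mul_le_of_le_one_right (abs_nonneg _) hξ.2)
  simp only [Complex.ofReal_one, mul_one] at hD hS1
  have hSξ' : ‖S q (ρ ^ 2) ξ‖ ≤ 2 / ‖ρ‖ * Real.exp |ρ.im| := hSξ.trans (by gcongr)
  rw [charFun]
  calc _ = ‖(derivWithin (S q (ρ ^ 2)) (Icc 0 1) 1 - Complex.cos ρ) + H * S q (ρ ^ 2) 1 -
        γ * S q (ρ ^ 2) ξ‖ := by ring_nf
    _ ≤ ‖derivWithin (S q (ρ ^ 2)) (Icc 0 1) 1 - Complex.cos ρ‖ + ‖(H : ℂ) * S q (ρ ^ 2) 1‖ +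
        ‖(γ : ℂ) * S q (ρ ^ 2) ξ‖ := (norm_sub_le _ _).trans (by gcongr; exact norm_add_le _ _)
    _ ≤ K * (2 / ‖ρ‖) * Real.exp |ρ.im| + |H| * (2 / ‖ρ‖ * Real.exp |ρ.im|) +
        |γ| * (2 / ‖ρ‖ * Real.exp |ρ.im|) := by
      rw [norm_mul, norm_mul, Complex.norm_real, Complex.norm_real, Real.norm_eq_abs,
        Real.norm_eq_abs]
      gcongr
    _ = _ := by ring

lemma exists_abs_le_of_continuousOn {f : ℝ → ℝ} (hf : ContinuousOn f (Icc 0 1)) :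
    ∃ K, ∀ x ∈ Icc (0 : ℝ) 1, |f x| ≤ K := by
  obtain ⟨K, hK⟩ := isCompact_Icc.exists_bound_of_continuousOn hf
  exact ⟨K, hK⟩

lemma hasDerivWithinAt_integral (hq : ContinuousOn q (Icc 0 1)) {x : ℝ} (hx : x ∈ Icc (0 : ℝ) 1) :
    HasDerivWithinAt (fun u => ∫ t in (0 : ℝ)..u, q t) (q x) (Icc 0 1) x := by
  have hc : Continuous (IccExtend (zero_le_one' ℝ) ((Icc (0 : ℝ) 1).domRestrict q)) :=
    (continuousOn_iff_continuous_domRestrict.1 hq).Icc_extend'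
  have heq : ∀ t ∈ Icc (0 : ℝ) 1,
      q t = IccExtend (zero_le_one' ℝ) ((Icc (0 : ℝ) 1).domRestrict q) t := fun t ht => by
    rw [IccExtend_of_mem _ _ ht]; rfl
  have h := (intervalIntegral.integral_hasDerivAt_right (hc.intervalIntegrable 0 x)
    (hc.stronglyMeasurableAtFilter volume _) hc.continuousAt).hasDerivWithinAt (s := Icc 0 1)
  rw [← heq x hx] at h
  have hI : ∀ u ∈ Icc (0 : ℝ) 1, ∫ t in (0 : ℝ)..u, q t = ∫ t in (0 : ℝ)..u,
      IccExtend (zero_le_one' ℝ) ((Icc (0 : ℝ) 1).domRestrict q) t := fun u hu =>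
    intervalIntegral.integral_congr fun t ht => by
      rw [uIcc_of_le hu.1] at ht
      exact heq t ⟨ht.1, ht.2.trans hu.2⟩
  exact h.congr hI (hI x hx)

lemma amplitude_bound_of_real (hq : ContinuousOn q (Icc 0 1)) {K : ℝ}
    (hK : ∀ x ∈ Icc (0 : ℝ) 1, |q x| ≤ K) {ρ : ℝ} (hρ0 : 0 < ρ) (hρ : 2 * K ≤ ρ)
    {σ : ℂ} (hσ : σ = Complex.I * ρ ∨ σ = -(Complex.I * ρ)) {x : ℝ} (hx : x ∈ Icc (0 : ℝ) 1) :
    ‖amplitude q σ x - 1‖ ≤ K * (2 / ρ) := by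
  have hre : σ.re = 0 := by rcases hσ with rfl | rfl <;> simp
  have hsq : -σ ^ 2 = (ρ : ℂ) ^ 2 := by
    rcases hσ with rfl | rfl
    exacts [sq_I_mul _, sq_neg_I_mul _]
  have hn : ‖(ρ : ℂ)‖ = ρ := by simp [abs_of_pos hρ0]
  have h := norm_amplitude_sub_one_le (M := 2 / ρ) hq (by positivity) hK σ
    (fun t ht => by
      have := norm_S_le hq hK (ρ := (ρ : ℂ)) (by exact_mod_cast hρ0.ne') (by rwa [hn]) ht
      rw [hn] at this
      simpa [hsq, hre] using this) hx
  simpa [hre] using h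

/-- The second order asymptotics of the amplitude. -/
lemma exists_norm_amplitude_sub_le (hq : ContDiffOn ℝ 1 q (Icc 0 1)) :
    ∃ C ρ₀ : ℝ, 0 < ρ₀ ∧ ∀ ρ : ℝ, ρ₀ ≤ ρ → ∀ x ∈ Icc (0 : ℝ) 1,
      ‖amplitude q (Complex.I * ρ) x - 1 -
        ((∫ t in (0 : ℝ)..x, q t : ℝ) : ℂ) / (2 * Complex.I * ρ)‖ ≤ C / ρ ^ 2 := by
  obtain ⟨K, hK⟩ := exists_abs_le_of_continuousOn hq.continuousOn
  obtain ⟨K', hK'⟩ := exists_abs_le_of_continuousOn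
    (hq.continuousOn_derivWithin (uniqueDiffOn_Icc zero_lt_one) le_rfl)
  have hK0 : 0 ≤ K := (abs_nonneg _).trans (hK 0 (left_mem_Icc.2 zero_le_one))
  refine ⟨2 * K ^ 2 + K' / 4 + K / 2, 2 * K + 1, by positivity, fun ρ hρ x hx => ?_⟩
  have hρ0 : 0 < ρ := by linarith
  have hρC : (ρ : ℂ) ≠ 0 := by exact_mod_cast hρ0.ne'
  set a := amplitude q (Complex.I * ρ) with ha
  set b := amplitude q (-(Complex.I * ρ)) with hb
  have ha1 : ∀ t ∈ Icc (0 : ℝ) 1, ‖a t - 1‖ ≤ K * (2 / ρ) := fun t ht =>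
    amplitude_bound_of_real hq.continuousOn hK hρ0 (by linarith) (Or.inl rfl) ht
  have hb1 : ∀ t ∈ Icc (0 : ℝ) 1, ‖b t - 1‖ ≤ K * (2 / ρ) := fun t ht =>
    amplitude_bound_of_real hq.continuousOn hK hρ0 (by linarith) (Or.inr rfl) ht
  set e : ℝ → ℂ := fun t => Complex.exp (-(Complex.I * ρ * t)) with he
  have hnorm : ∀ t, ‖e t‖ = 1 := fun t => by
    simp only [he]; rw [Complex.norm_exp]; simp
  have hede : ∀ t : ℝ, HasDerivAt e (e t * (-(Complex.I * ρ * 1))) t := fun t =>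
    (((Complex.ofRealCLM.hasDerivAt (x := t)).const_mul (Complex.I * (ρ : ℂ))).neg).cexp
  have hS : ∀ t, e t * S q (-(Complex.I * ρ) ^ 2) t =
      (a t - b t * e t ^ 2) / (2 * Complex.I * ρ) := fun t => by
    have h1 := amplitude_mul_exp q (Complex.I * ρ) t
    have h2 := amplitude_mul_exp q (-(Complex.I * ρ)) t
    rw [neg_sq] at h2
    rw [neg_mul] at h2
    have h3 : Complex.exp (Complex.I * ρ * t) * e t = 1 := by
      simp only [he]; rw [← Complex.exp_add]; simp
    rw [eq_div_iff (by simp [hρC])]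
    change a t * _ = _ at h1
    change b t * e t = _ at h2
    linear_combination e t * h2 - e t * h1 + a t * h3
  set F : ℝ → ℂ := fun t => a t - ((∫ s in (0 : ℝ)..t, q s : ℝ) : ℂ) / (2 * Complex.I * ρ) +
    (q t : ℂ) * e t ^ 2 / (4 * ρ ^ 2) with hF
  have hFd : ∀ t ∈ Icc (0 : ℝ) 1, HasDerivWithinAt F
      ((q t : ℂ) * ((a t - 1) - (b t - 1) * e t ^ 2) / (2 * Complex.I * ρ) +
        ((derivWithin q (Icc 0 1) t : ℝ) : ℂ) * e t ^ 2 / (4 * ρ ^ 2)) (Icc 0 1) t := fun t ht => by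
    have h1 := hasDerivWithinAt_amplitude hq.continuousOn (Complex.I * ρ) ht
    have h2 := (hasDerivWithinAt_integral hq.continuousOn ht).ofReal_comp
    have h3 := ((hq.differentiableOn one_ne_zero) t ht).hasDerivWithinAt.ofReal_comp
    have h4 := ((hede t).pow 2).hasDerivWithinAt (s := Icc (0 : ℝ) 1)
    refine ((h1.sub (h2.div_const (2 * Complex.I * ρ))).add
      ((h3.mul h4).div_const (4 * ρ ^ 2))).congr_deriv ?_
    have h5 := hS t
    have h6 : Complex.exp (-(Complex.I * ρ * t)) * ((q t : ℂ) * S q (-(Complex.I * ρ) ^ 2) t) =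
        q t * ((a t - b t * e t ^ 2) / (2 * Complex.I * ρ)) := by
      rw [← h5]; ring
    rw [h6]
    have hI := Complex.I_ne_zero
    have hI2 := Complex.I_sq
    field_simp
    ring_nf
    simp only [hI2, Pi.pow_apply]
    ring
  have hbd : ∀ t ∈ Icc (0 : ℝ) 1, ‖(q t : ℂ) * ((a t - 1) - (b t - 1) * e t ^ 2) /
      (2 * Complex.I * ρ) + ((derivWithin q (Icc 0 1) t : ℝ) : ℂ) * e t ^ 2 / (4 * ρ ^ 2)‖ ≤
      (2 * K ^ 2 + K' / 4) / ρ ^ 2 := fun t ht => by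
    refine (norm_add_le _ _).trans ?_
    have n1 : ‖2 * Complex.I * (ρ : ℂ)‖ = 2 * ρ := by simp [abs_of_pos hρ0]
    have n2 : ‖4 * (ρ : ℂ) ^ 2‖ = 4 * ρ ^ 2 := by simp
    rw [norm_div, norm_div, n1, n2, norm_mul, norm_mul, norm_pow, hnorm, Complex.norm_real,
      Complex.norm_real, Real.norm_eq_abs, Real.norm_eq_abs]
    have h1 : ‖(a t - 1) - (b t - 1) * e t ^ 2‖ ≤ K * (2 / ρ) + K * (2 / ρ) := by
      refine (norm_sub_le _ _).trans (add_le_add (ha1 t ht) ?_)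
      rw [norm_mul, norm_pow, hnorm]; simpa using hb1 t ht
    calc _ ≤ K * (K * (2 / ρ) + K * (2 / ρ)) / (2 * ρ) + K' * 1 ^ 2 / (4 * ρ ^ 2) := by
          gcongr
          · exact hK t ht
          · exact hK' t ht
      _ = _ := by field_simp; ring
  have hmv := (convex_Icc (0 : ℝ) 1).norm_image_sub_le_of_norm_hasDerivWithin_le hFd hbd
    (left_mem_Icc.2 zero_le_one) hx
  have hK'0 : 0 ≤ K' := (abs_nonneg _).trans (hK' 0 (left_mem_Icc.2 zero_le_one))
  have hmv' : ‖F x - F 0‖ ≤ (2 * K ^ 2 + K' / 4) / ρ ^ 2 := by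
    refine hmv.trans (mul_le_of_le_one_right (by positivity) ?_)
    rw [sub_zero, Real.norm_eq_abs, abs_of_nonneg hx.1]; exact hx.2
  have hqe : ∀ t ∈ Icc (0 : ℝ) 1, ‖(q t : ℂ) * e t ^ 2 / (4 * ρ ^ 2)‖ ≤ K / 4 / ρ ^ 2 :=
    fun t ht => by
      have n2 : ‖4 * (ρ : ℂ) ^ 2‖ = 4 * ρ ^ 2 := by simp
      rw [norm_div, norm_mul, norm_pow, hnorm, Complex.norm_real, Real.norm_eq_abs, n2]
      calc _ ≤ K * 1 ^ 2 / (4 * ρ ^ 2) := by gcongr; exact hK t ht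
        _ = _ := by field_simp
  have ha0 : a 0 = 1 := amplitude_zero hq.continuousOn _
  have hid : a x - 1 - ((∫ t in (0 : ℝ)..x, q t : ℝ) : ℂ) / (2 * Complex.I * ρ) =
      (F x - F 0) - (q x : ℂ) * e x ^ 2 / (4 * ρ ^ 2) + (q 0 : ℂ) * e 0 ^ 2 / (4 * ρ ^ 2) := by
    simp only [hF, ha0, intervalIntegral.integral_same]
    push_cast; ring
  rw [hid]
  calc _ ≤ ‖F x - F 0‖ + ‖(q x : ℂ) * e x ^ 2 / (4 * ρ ^ 2)‖ +
        ‖(q 0 : ℂ) * e 0 ^ 2 / (4 * ρ ^ 2)‖ :=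
        (norm_add_le _ _).trans (by gcongr; exact norm_sub_le _ _)
    _ ≤ (2 * K ^ 2 + K' / 4) / ρ ^ 2 + K / 4 / ρ ^ 2 + K / 4 / ρ ^ 2 := by
        gcongr
        exacts [hqe x hx, hqe 0 (left_mem_Icc.2 zero_le_one)]
    _ = _ := by ring

lemma analyticOrderAt_sub_const (a z : ℂ) :
    analyticOrderAt (fun w => w - a) z = ((if a = z then 1 else 0 : ℕ) : ℕ∞) := by
  have han : AnalyticAt ℂ (fun w => w - a) z := by fun_prop
  split_ifs with h
  · subst h
    rw [Nat.cast_one]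
    exact han.analyticOrderAt_eq_one_of_zero_deriv_ne_zero (by simp) (by simp)
  · rw [Nat.cast_zero, han.analyticOrderAt_eq_zero]
    exact sub_ne_zero.2 fun e => h e.symm

lemma continuousOn_deriv_div {f : ℂ → ℂ} (hf : Differentiable ℂ f) {s : Set ℂ}
    (h : ∀ z ∈ s, f z ≠ 0) : ContinuousOn (fun z => deriv f z / f z) s :=
  (hf.contDiff (n := 1)).continuous_deriv_one.continuousOn.div hf.continuous.continuousOn h

/-- The argument principle for an entire function whose zeros in a disc, counted with
multiplicities, are listed by a finite family. -/
theorem circleIntegral_deriv_div_eq_card {ι : Type*} [DecidableEq ι] {R : ℝ} (hR : 0 < R)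
    (Λ : ι → ℂ) (s : Finset ι) {f : ℂ → ℂ} (hf : Differentiable ℂ f)
    (hs : ∀ i ∈ s, Λ i ∈ Metric.ball (0 : ℂ) R)
    (hord : ∀ z ∈ Metric.closedBall (0 : ℂ) R,
      ((s.filter fun i => Λ i = z).card : ℕ∞) = analyticOrderAt f z) :
    (∮ z in C(0, R), deriv f z / f z) = 2 * Real.pi * Complex.I * s.card := by
  induction s using Finset.induction_on generalizing f with
  | empty =>
    have hne : ∀ z ∈ Metric.closedBall (0 : ℂ) R, f z ≠ 0 := fun z hz => by
      have h := (hord z hz).symm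
      simp only [Finset.filter_empty, Finset.card_empty, Nat.cast_zero] at h
      exact (hf.analyticAt z).analyticOrderAt_eq_zero.1 h
    rw [Complex.circleIntegral_eq_zero_of_differentiable_on_off_countable hR.le countable_empty
      (continuousOn_deriv_div hf hne) fun z hz => ?_]
    · simp
    · exact (((hf.analyticAt z).deriv).differentiableAt).div (hf z)
        (hne z (Metric.ball_subset_closedBall hz.1))
  | insert i s hi ih =>
    set a := Λ i with ha
    have haR : a ∈ Metric.ball (0 : ℂ) R := hs i (Finset.mem_insert_self i s)
    have hfa : f a = 0 := by
      refine apply_eq_zero_of_analyticOrderAt_ne_zero (𝕜 := ℂ) ?_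
      rw [← hord a (Metric.ball_subset_closedBall haR)]
      have : i ∈ (insert i s).filter fun i => Λ i = a := by simp [ha]
      exact_mod_cast (Finset.card_pos.2 ⟨i, this⟩).ne'
    set g := dslope f a with hg
    have hgd : Differentiable ℂ g := by
      rw [← differentiableOn_univ, hg, Complex.differentiableOn_dslope univ_mem]
      exact hf.differentiableOn
    have hfg : ∀ z, f z = (z - a) * g z := fun z => by
      have := sub_smul_dslope f a z
      rw [hfa, sub_zero, smul_eq_mul] at this
      exact this.symm
    have hfg' : f = (fun w => w - a) * g := funext hfg
    have hordf : ∀ z, analyticOrderAt f z =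
        ((if a = z then 1 else 0 : ℕ) : ℕ∞) + analyticOrderAt g z := fun z => by
      rw [hfg', analyticOrderAt_mul (by fun_prop) (hgd.analyticAt z), analyticOrderAt_sub_const]
    have hordg : ∀ z ∈ Metric.closedBall (0 : ℂ) R,
        ((s.filter fun i => Λ i = z).card : ℕ∞) = analyticOrderAt g z := fun z hz => by
      have h := hord z hz
      have hc : ((insert i s).filter fun i => Λ i = z).card =
          (if a = z then 1 else 0 : ℕ) + (s.filter fun i => Λ i = z).card := by
        rw [Finset.filter_insert]
        split_ifs with h1
        · rw [Finset.card_insert_of_notMem (by simp [hi]), add_comm]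
        · rw [zero_add]
      rw [hordf, hc, Nat.cast_add] at h
      exact WithTop.add_left_cancel (ENat.natCast_ne_top _) h
    have hgI := ih hgd (fun j hj => hs j (Finset.mem_insert_of_mem hj)) hordg
    have hne : ∀ z ∈ Metric.sphere (0 : ℂ) R, z - a ≠ 0 ∧ g z ≠ 0 := fun z hz => by
      have h1 : ∀ j ∈ insert i s, Λ j ≠ z := fun j hj e => by
        have := hs j hj
        rw [e, mem_ball_zero_iff, mem_sphere_zero_iff_norm.1 hz] at this
        exact lt_irrefl _ this
      refine ⟨sub_ne_zero.2 (h1 i (Finset.mem_insert_self i s)).symm, ?_⟩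
      have h := (hordg z (Metric.sphere_subset_closedBall hz)).symm
      rw [Finset.filter_eq_empty_iff.2 fun j hj => h1 j (Finset.mem_insert_of_mem hj)] at h
      exact (hgd.analyticAt z).analyticOrderAt_eq_zero.1 (by simpa using h)
    have hcongr : EqOn (fun z => deriv f z / f z) (fun z => (z - a)⁻¹ + deriv g z / g z)
        (Metric.sphere (0 : ℂ) R) := fun z hz => by
      obtain ⟨h1, h2⟩ := hne z hz
      have hd : deriv f z = g z + (z - a) * deriv g z := by
        rw [hfg']
        have := ((hasDerivAt_id z).sub_const a).mul (hgd z).hasDerivAt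
        simpa using this.deriv
      simp only
      rw [hd, hfg z]
      field_simp
    rw [circleIntegral.integral_congr hR.le hcongr, circleIntegral.integral_add,
      circleIntegral.integral_sub_inv_of_mem_ball haR, hgI, Finset.card_insert_of_notMem hi]
    · push_cast; ring
    · exact ContinuousOn.circleIntegrable hR.le
        ((continuousOn_id.sub continuousOn_const).inv₀ fun z hz => (hne z hz).1)
    · exact (continuousOn_deriv_div hgd fun z hz => (hne z hz).2).circleIntegrable hR.le

/-- Functions that are close on a circle have the same integral of the logarithmic derivative. -/
theorem circleIntegral_deriv_div_eq_of_norm_sub_lt {R : ℝ} (hR : 0 < R) {f f₀ : ℂ → ℂ}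
    (hf : Differentiable ℂ f) (hf₀ : Differentiable ℂ f₀)
    (h : ∀ z ∈ Metric.sphere (0 : ℂ) R, ‖f z - f₀ z‖ < ‖f₀ z‖) :
    (∮ z in C(0, R), deriv f z / f z) = ∮ z in C(0, R), deriv f₀ z / f₀ z := by
  have hne₀ : ∀ z ∈ Metric.sphere (0 : ℂ) R, f₀ z ≠ 0 := fun z hz e => by
    have := h z hz
    rw [e, norm_zero] at this
    exact (norm_nonneg _).not_gt this
  have hne : ∀ z ∈ Metric.sphere (0 : ℂ) R, f z ≠ 0 := fun z hz e => by
    have := h z hz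
    rw [e, zero_sub, norm_neg] at this
    exact lt_irrefl _ this
  rw [← sub_eq_zero, ← circleIntegral.integral_sub
    ((continuousOn_deriv_div hf hne).circleIntegrable hR.le)
    ((continuousOn_deriv_div hf₀ hne₀).circleIntegrable hR.le)]
  refine circleIntegral.integral_eq_zero_of_hasDerivWithinAt
    (f := fun z => Complex.log (f z / f₀ z)) hR.le fun z hz => ?_
  have h1 : f z / f₀ z ∈ Complex.slitPlane := by
    refine Complex.ball_one_subset_slitPlane ?_
    rw [mem_ball_iff_norm, div_sub_one (hne₀ z hz), norm_div, div_lt_one]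
    · exact h z hz
    · exact norm_pos_iff.2 (hne₀ z hz)
  refine ((((hf z).hasDerivAt.div (hf₀ z).hasDerivAt (hne₀ z hz)).clog
    h1).hasDerivWithinAt).congr_deriv ?_
  have := hne z hz
  have := hne₀ z hz
  simp only [Pi.div_apply]
  field_simp

lemma not_frequently_eq_zero {f : ℂ → ℂ} (hf : Differentiable ℂ f) {w : ℂ} (hw : f w ≠ 0) (z : ℂ) :
    ¬ ∃ᶠ u in 𝓝[≠] z, f u = 0 := fun h =>
  hw <| AnalyticOnNhd.eqOn_zero_of_preconnected_of_frequently_eq_zero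
    (fun u _ => hf.analyticAt u) isPreconnected_univ (mem_univ z) h (mem_univ w)

lemma analyticOrderAt_ne_top {f : ℂ → ℂ} (hf : Differentiable ℂ f) {w : ℂ} (hw : f w ≠ 0)
    (z : ℂ) : analyticOrderAt f z ≠ ⊤ := fun h =>
  not_frequently_eq_zero hf hw z
    ((analyticOrderAt_eq_top.1 h).filter_mono nhdsWithin_le_nhds).frequently

lemma finite_zeros_closedBall {f : ℂ → ℂ} (hf : Differentiable ℂ f) {w : ℂ} (hw : f w ≠ 0)
    (R : ℝ) : {z | z ∈ Metric.closedBall (0 : ℂ) R ∧ f z = 0}.Finite := by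
  by_contra hinf
  obtain ⟨z, -, hz⟩ := Set.Infinite.exists_accPt_of_subset_isCompact hinf
    (isCompact_closedBall (0 : ℂ) R) fun z hz => hz.1
  rw [accPt_iff_frequently_nhdsNE] at hz
  exact not_frequently_eq_zero hf hw z (hz.mono fun u hu => hu.2)

/-- Rouché's theorem on a disc about `0`, for listed zeros. -/
theorem ncard_norm_lt_eq_of_norm_sub_lt {R : ℝ} (hR : 0 < R) {f f₀ : ℂ → ℂ}
    (hf : Differentiable ℂ f) (hf₀ : Differentiable ℂ f₀)
    (h : ∀ z ∈ Metric.sphere (0 : ℂ) R, ‖f z - f₀ z‖ < ‖f₀ z‖)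
    {Λ Λ₀ : ℕ → ℂ} (hΛ : ∀ z, {n | Λ n = z}.encard = analyticOrderAt f z) {s₀ : Finset ℕ}
    (hs₀ : ∀ i ∈ s₀, Λ₀ i ∈ Metric.ball (0 : ℂ) R)
    (hord₀ : ∀ z ∈ Metric.closedBall (0 : ℂ) R,
      ((s₀.filter fun i => Λ₀ i = z).card : ℕ∞) = analyticOrderAt f₀ z) :
    ∃ s : Finset ℕ, (∀ n, n ∈ s ↔ ‖Λ n‖ < R) ∧ s.card = s₀.card := by
  have hne : ∀ z ∈ Metric.sphere (0 : ℂ) R, f z ≠ 0 := fun z hz e => by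
    have := h z hz
    rw [e, zero_sub, norm_neg] at this
    exact lt_irrefl _ this
  have hRs : (R : ℂ) ∈ Metric.sphere (0 : ℂ) R := by simp [abs_of_pos hR]
  have hfib : ∀ n, f (Λ n) = 0 := fun n => by
    refine apply_eq_zero_of_analyticOrderAt_ne_zero (𝕜 := ℂ) ?_
    rw [← hΛ, Set.encard_ne_zero]
    exact ⟨n, rfl⟩
  have hfin : {n | ‖Λ n‖ < R}.Finite := by
    refine ((finite_zeros_closedBall hf (hne _ hRs) R).biUnion
      (t := fun z => {n | Λ n = z}) fun z _ => ?_).subset fun n hn => ?_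
    · rw [← Set.encard_ne_top_iff, hΛ]
      exact analyticOrderAt_ne_top hf (hne _ hRs) z
    · simp only [mem_iUnion]
      exact ⟨Λ n, ⟨mem_closedBall_zero_iff.2 (le_of_lt hn), hfib n⟩, rfl⟩
  refine ⟨hfin.toFinset, by simp, ?_⟩
  have h1 := circleIntegral_deriv_div_eq_card hR Λ hfin.toFinset hf (by simp) fun z hz => by
    rw [← hΛ z, ← Set.encard_coe_eq_coe_finsetCard]
    congr 1
    ext n
    simp only [Finset.coe_filter, Finite.mem_toFinset, mem_ofPred_eq, and_iff_right_iff_imp]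
    rintro rfl
    refine lt_of_le_of_ne (mem_closedBall_zero_iff.1 hz) fun e => ?_
    exact hne _ (mem_sphere_zero_iff_norm.2 e) (hfib n)
  have h2 := circleIntegral_deriv_div_eq_card hR Λ₀ s₀ hf₀ hs₀ hord₀
  rw [circleIntegral_deriv_div_eq_of_norm_sub_lt hR hf hf₀ h, h2] at h1
  have h3 := mul_left_cancel₀ Complex.two_pi_I_ne_zero h1
  exact_mod_cast h3.symm

/-- The Prüfer phase of `S q (ρ²)`. -/
noncomputable def phase (q : ℝ → ℝ) (ρ x : ℝ) : ℝ :=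
  ρ * x + (amplitude q (Complex.I * ρ) x).arg

lemma phase_zero (hq : ContinuousOn q (Icc 0 1)) (ρ : ℝ) : phase q ρ 0 = 0 := by
  simp [phase, amplitude_zero hq]

lemma im_S_sq (hq : ContinuousOn q (Icc 0 1)) (ρ : ℝ) {x : ℝ} (hx : x ∈ Icc (0 : ℝ) 1) :
    (S q ((ρ : ℂ) ^ 2) x).im = 0 := by
  have := im_S_ofReal hq (ρ ^ 2) hx
  rwa [Complex.ofReal_pow] at this

lemma im_derivWithin_S_sq (hq : ContinuousOn q (Icc 0 1)) (ρ : ℝ) {x : ℝ}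
    (hx : x ∈ Icc (0 : ℝ) 1) : (derivWithin (S q ((ρ : ℂ) ^ 2)) (Icc 0 1) x).im = 0 := by
  have := im_derivWithin_S_ofReal hq (ρ ^ 2) hx
  rwa [Complex.ofReal_pow] at this

lemma amplitude_mul_exp_real (q : ℝ → ℝ) (ρ x : ℝ) :
    amplitude q (Complex.I * ρ) x * Complex.exp ((ρ * x : ℝ) * Complex.I) =
      derivWithin (S q ((ρ : ℂ) ^ 2)) (Icc 0 1) x + Complex.I * ρ * S q ((ρ : ℂ) ^ 2) x := by
  have h := amplitude_mul_exp q (Complex.I * ρ) x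
  rw [sq_I_mul] at h
  rw [← h]
  push_cast
  ring_nf

lemma mul_S_eq (hq : ContinuousOn q (Icc 0 1)) (ρ : ℝ) {x : ℝ} (hx : x ∈ Icc (0 : ℝ) 1) :
    ρ * (S q ((ρ : ℂ) ^ 2) x).re =
      ‖amplitude q (Complex.I * ρ) x‖ * Real.sin (phase q ρ x) := by
  have h := amplitude_mul_exp_real q ρ x
  rw [← Complex.norm_mul_exp_arg_mul_I (amplitude q (Complex.I * ρ) x), mul_assoc,
    ← Complex.exp_add, ← add_mul, ← Complex.ofReal_add] at h
  have h1 := congrArg Complex.im h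
  rw [Complex.im_ofReal_mul, Complex.exp_ofReal_mul_I_im, Complex.add_im,
    im_derivWithin_S_sq hq ρ hx] at h1
  rw [phase, add_comm (ρ * x), h1]
  simp

lemma strictMonoOn_phase (hq : ContinuousOn q (Icc 0 1)) {K : ℝ}
    (hK : ∀ x ∈ Icc (0 : ℝ) 1, |q x| ≤ K) {ρ : ℝ} (hρ : 4 * K + 2 ≤ ρ) :
    (∀ x ∈ Icc (0 : ℝ) 1, ‖amplitude q (Complex.I * ρ) x - 1‖ ≤ 1 / 2) ∧
    ContinuousOn (phase q ρ) (Icc 0 1) ∧ StrictMonoOn (phase q ρ) (Icc 0 1) := by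
  have hK0 : 0 ≤ K := (abs_nonneg _).trans (hK 0 (left_mem_Icc.2 zero_le_one))
  have hρ0 : 0 < ρ := by linarith
  have hKρ : K * (2 / ρ) ≤ 1 / 2 := by
    rw [mul_div, div_le_iff₀ hρ0]; linarith
  have ha : ∀ x ∈ Icc (0 : ℝ) 1, ‖amplitude q (Complex.I * ρ) x - 1‖ ≤ 1 / 2 := fun x hx =>
    (amplitude_bound_of_real hq hK hρ0 (by linarith) (Or.inl rfl) hx).trans hKρ
  have hd : ∀ x ∈ Icc (0 : ℝ) 1, HasDerivWithinAt (phase q ρ)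
      (ρ + (Complex.exp (-(Complex.I * ρ * x)) * (q x * S q (-(Complex.I * ρ) ^ 2) x) /
        amplitude q (Complex.I * ρ) x).im) (Icc 0 1) x := fun x hx => by
    have hsp : amplitude q (Complex.I * ρ) x ∈ Complex.slitPlane :=
      Complex.ball_one_subset_slitPlane (mem_ball_iff_norm.2 ((ha x hx).trans_lt (by norm_num)))
    have h1 := (hasDerivWithinAt_amplitude hq (Complex.I * ρ) hx).clog_real hsp
    have h2 : HasDerivWithinAt (fun x => (amplitude q (Complex.I * ρ) x).arg) _ (Icc 0 1) x :=
      (Complex.imCLM.hasFDerivAt.comp_hasDerivWithinAt x h1).congr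
        (fun t _ => (Complex.log_im _).symm) (Complex.log_im _).symm
    have h3 : HasDerivWithinAt (fun x : ℝ => ρ * x) ρ (Icc 0 1) x := by
      simpa using ((hasDerivAt_id x).const_mul ρ).hasDerivWithinAt
    exact h3.add h2
  have hcont : ContinuousOn (phase q ρ) (Icc 0 1) := fun x hx => (hd x hx).continuousWithinAt
  refine ⟨ha, hcont, strictMonoOn_of_hasDerivWithinAt_pos (convex_Icc 0 1) hcont
    (fun x hx => (hd x (interior_subset hx)).mono interior_subset) fun x hx => ?_⟩
  have hx' := interior_subset hx
  set a := amplitude q (Complex.I * ρ) x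
  have ha2 : 1 / 2 ≤ ‖a‖ := by
    have := norm_sub_norm_le (1 : ℂ) a
    rw [norm_one, norm_sub_rev] at this
    linarith [ha x hx']
  have hn : ‖(ρ : ℂ)‖ = ρ := by simp [abs_of_pos hρ0]
  have hS := norm_S_le hq hK (ρ := (ρ : ℂ)) (by exact_mod_cast hρ0.ne')
    (by rw [hn]; linarith) hx'
  rw [hn, Complex.ofReal_im, abs_zero, zero_mul, Real.exp_zero, mul_one] at hS
  have hb : ‖Complex.exp (-(Complex.I * ρ * x)) * (q x * S q (-(Complex.I * ρ) ^ 2) x) / a‖ ≤ 1 := by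
    rw [norm_div, div_le_one (by linarith), norm_mul, norm_mul, sq_I_mul, Complex.norm_exp,
      Complex.norm_real, Real.norm_eq_abs]
    have e : (-(Complex.I * ρ * (x : ℂ))).re = 0 := by simp
    rw [e, Real.exp_zero, one_mul]
    calc |q x| * ‖S q ((ρ : ℂ) ^ 2) x‖ ≤ K * (2 / ρ) := by
          gcongr
          exact hK x hx'
      _ ≤ ‖a‖ := hKρ.trans ha2
  have := (abs_le.1 ((Complex.abs_im_le_norm _).trans hb)).1
  linarith

/-- At the `j`-th node the Prüfer phase is `j π`. -/
lemma phase_eq_of_index (hq : ContinuousOn q (Icc 0 1)) {K : ℝ}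
    (hK : ∀ x ∈ Icc (0 : ℝ) 1, |q x| ≤ K) {ρ : ℝ} (hρ : 4 * K + 2 ≤ ρ) {y : ℝ} {j : ℕ}
    (hy : y ∈ nodes q ((ρ : ℂ) ^ 2))
    (hj : (nodes q ((ρ : ℂ) ^ 2) ∩ Iic y).encard = (j : ℕ∞)) : phase q ρ y = j * Real.pi := by
  obtain ⟨ha, hcont, hmono⟩ := strictMonoOn_phase hq hK hρ
  have hK0 : 0 ≤ K := (abs_nonneg _).trans (hK 0 (left_mem_Icc.2 zero_le_one))
  have hρ0 : 0 < ρ := by linarith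
  have hzero : ∀ x ∈ Icc (0 : ℝ) 1, S q ((ρ : ℂ) ^ 2) x = 0 ↔ Real.sin (phase q ρ x) = 0 := by
    intro x hx
    have h1 := mul_S_eq hq ρ hx
    have h2 : ‖amplitude q (Complex.I * ρ) x‖ ≠ 0 := by
      rw [norm_ne_zero_iff]
      intro e
      have := ha x hx
      rw [e] at this
      norm_num at this
    constructor
    · intro h
      rw [h, Complex.zero_re, mul_zero] at h1
      exact (mul_eq_zero.1 h1.symm).resolve_left h2
    · intro h
      rw [h, mul_zero] at h1
      exact Complex.ext ((mul_eq_zero.1 h1).resolve_left hρ0.ne') (im_S_sq hq ρ hx)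
  have h0 : (0 : ℝ) ∈ Icc (0 : ℝ) 1 := left_mem_Icc.2 zero_le_one
  have hy' : y ∈ Icc (0 : ℝ) 1 := ⟨hy.1.1.le, hy.1.2.le⟩
  have hpos : ∀ x ∈ Ioo (0 : ℝ) 1, 0 < phase q ρ x := fun x hx => by
    rw [← phase_zero hq ρ]
    exact hmono h0 ⟨hx.1.le, hx.2.le⟩ hx.1
  have hnat : ∀ x ∈ nodes q ((ρ : ℂ) ^ 2), ∃ k : ℕ, 1 ≤ k ∧ phase q ρ x = k * Real.pi := by
    intro x hx
    obtain ⟨m, hm⟩ := Real.sin_eq_zero_iff.1 ((hzero x ⟨hx.1.1.le, hx.1.2.le⟩).1 hx.2)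
    have hm0 : 0 < m := by
      have := hpos x hx.1
      rw [← hm] at this
      exact_mod_cast pos_of_mul_pos_left this Real.pi_pos.le
    lift m to ℕ using hm0.le
    exact ⟨m, by exact_mod_cast hm0, by rw [← hm]; simp⟩
  obtain ⟨k, hk1, hk⟩ := hnat y hy
  have himage : phase q ρ '' (nodes q ((ρ : ℂ) ^ 2) ∩ Iic y) =
      (fun i : ℕ => (i : ℝ) * Real.pi) '' (Finset.Icc 1 k : Finset ℕ) := by
    ext t
    constructor
    · rintro ⟨x, ⟨hx, hxy⟩, rfl⟩
      obtain ⟨i, hi1, hi⟩ := hnat x hx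
      refine ⟨i, ?_, hi.symm⟩
      have h1 := hmono.monotoneOn ⟨hx.1.1.le, hx.1.2.le⟩ hy' hxy
      rw [hi, hk] at h1
      have h2 : (i : ℝ) ≤ k := le_of_mul_le_mul_right h1 Real.pi_pos
      simp only [Finset.coe_Icc, mem_Icc]
      exact ⟨hi1, by exact_mod_cast h2⟩
    · rintro ⟨i, hi, rfl⟩
      simp only [Finset.coe_Icc, mem_Icc] at hi
      have hi1 : (1 : ℝ) ≤ i := by exact_mod_cast hi.1
      have hik : (i : ℝ) ≤ k := by exact_mod_cast hi.2
      have hmem : (i : ℝ) * Real.pi ∈ Icc (phase q ρ 0) (phase q ρ y) := by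
        rw [phase_zero hq, hk]
        exact ⟨by positivity, mul_le_mul_of_nonneg_right hik Real.pi_pos.le⟩
      obtain ⟨x, hx, hxi⟩ := intermediate_value_Icc hy'.1
        (hcont.mono (Icc_subset_Icc_right hy'.2)) hmem
      have hx0 : x ≠ 0 := by
        rintro rfl
        rw [phase_zero hq] at hxi
        have : 0 < (i : ℝ) * Real.pi := by positivity
        exact this.ne hxi
      have hxI : x ∈ Ioo (0 : ℝ) 1 := ⟨lt_of_le_of_ne hx.1 hx0.symm, lt_of_le_of_lt hx.2 hy.1.2⟩
      have hS0 : S q ((ρ : ℂ) ^ 2) x = 0 := by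
        rw [hzero x ⟨hx.1, hxI.2.le⟩, hxi]
        exact Real.sin_nat_mul_pi i
      exact ⟨x, ⟨⟨hxI, hS0⟩, hx.2⟩, hxi⟩
  have hinj1 : InjOn (phase q ρ) (nodes q ((ρ : ℂ) ^ 2) ∩ Iic y) :=
    hmono.injOn.mono (show _ ⊆ Icc (0 : ℝ) 1 from fun x hx => ⟨hx.1.1.1.le, hx.1.1.2.le⟩)
  have hinj2 : Function.Injective fun i : ℕ => (i : ℝ) * Real.pi := fun a b hab => by
    exact_mod_cast mul_right_cancel₀ Real.pi_pos.ne' hab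
  have hcard := congrArg Set.encard himage
  rw [hinj1.encard_image, hinj2.encard_image, hj, Set.encard_coe_eq_coe_finsetCard,
    Nat.card_Icc] at hcard
  have : j = k := by
    have : j = k + 1 - 1 := by exact_mod_cast hcard
    omega
  rw [hk, this]

/-- The argument of the amplitude is `-Q(x)/(2ρ)` up to `O(1/ρ²)`, where `Q' = q`. -/
lemma exists_abs_mul_arg_add_le (hq : ContDiffOn ℝ 1 q (Icc 0 1)) :
    ∃ C ρ₀ : ℝ, 0 ≤ C ∧ ∀ ρ : ℝ, ρ₀ ≤ ρ → ∀ x ∈ Icc (0 : ℝ) 1,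
      |ρ * (amplitude q (Complex.I * ρ) x).arg + (∫ t in (0 : ℝ)..x, q t) / 2| ≤ C / ρ := by
  obtain ⟨K, hK⟩ := exists_abs_le_of_continuousOn hq.continuousOn
  have hK0 : 0 ≤ K := (abs_nonneg _).trans (hK 0 (left_mem_Icc.2 zero_le_one))
  obtain ⟨C, ρ₀, hρ₀, hC⟩ := exists_norm_amplitude_sub_le hq
  have h0C : 0 ≤ C := by
    have h := (norm_nonneg _).trans (hC ρ₀ le_rfl 0 (left_mem_Icc.2 zero_le_one))
    by_contra hneg
    exact absurd h (not_le.2 (div_neg_of_neg_of_pos (not_le.1 hneg) (by positivity)))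
  refine ⟨4 * K ^ 2 + C, max ρ₀ (4 * K + 2), by positivity, fun ρ hρ x hx => ?_⟩
  have hρ1 : ρ₀ ≤ ρ := (le_max_left _ _).trans hρ
  have hρ2 : 4 * K + 2 ≤ ρ := (le_max_right _ _).trans hρ
  have hρ0 : 0 < ρ := by linarith
  have h1 := (strictMonoOn_phase hq.continuousOn hK hρ2).1 x hx
  have h2 := amplitude_bound_of_real hq.continuousOn hK hρ0 (by linarith) (Or.inl rfl) hx
  have h3 := hC ρ hρ1 x hx
  set a := amplitude q (Complex.I * ρ) x
  set Q := ∫ t in (0 : ℝ)..x, q t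
  have h4 : ‖Complex.log a - (a - 1)‖ ≤ ‖a - 1‖ ^ 2 := by
    have h := Complex.norm_log_one_add_sub_self_le (z := a - 1) (h1.trans_lt (by norm_num))
    rw [add_sub_cancel] at h
    refine h.trans ?_
    have h5 : (1 - ‖a - 1‖)⁻¹ ≤ 2 := by
      rw [inv_le_comm₀ (by linarith) (by norm_num)]
      linarith
    calc ‖a - 1‖ ^ 2 * (1 - ‖a - 1‖)⁻¹ / 2 ≤ ‖a - 1‖ ^ 2 * 2 / 2 := by gcongr
      _ = _ := by ring
  have h5 : ‖Complex.log a - (Q : ℂ) / (2 * Complex.I * ρ)‖ ≤ (4 * K ^ 2 + C) / ρ ^ 2 := by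
    calc _ = ‖(Complex.log a - (a - 1)) + (a - 1 - (Q : ℂ) / (2 * Complex.I * ρ))‖ := by ring_nf
      _ ≤ (K * (2 / ρ)) ^ 2 + C / ρ ^ 2 :=
        (norm_add_le _ _).trans (add_le_add (h4.trans (by gcongr)) h3)
      _ = _ := by field_simp; ring
  have h6 : (Complex.log a - (Q : ℂ) / (2 * Complex.I * ρ)).im = a.arg + Q / (2 * ρ) := by
    have : (Q : ℂ) / (2 * Complex.I * ρ) = ((-(Q / (2 * ρ)) : ℝ) : ℂ) * Complex.I := by
      have hρC : (ρ : ℂ) ≠ 0 := by exact_mod_cast hρ0.ne'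
      have hI := Complex.I_ne_zero
      push_cast
      field_simp
      rw [Complex.I_sq]; ring
    rw [this, Complex.sub_im, Complex.log_im, Complex.im_ofReal_mul, Complex.I_im]
    ring
  have h7 := (Complex.abs_im_le_norm _).trans h5
  rw [h6] at h7
  have h8 : ρ * a.arg + Q / 2 = ρ * (a.arg + Q / (2 * ρ)) := by field_simp
  rw [h8, abs_mul, abs_of_pos hρ0]
  calc _ ≤ ρ * ((4 * K ^ 2 + C) / ρ ^ 2) := by gcongr
    _ = _ := by field_simp

lemma exp_div_four_le_norm_cos {N : ℕ} (hN : 1 ≤ N) {ρ : ℂ} (hρ : ‖ρ‖ = N * Real.pi) :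
    Real.exp |ρ.im| / 4 ≤ ‖Complex.cos ρ‖ := by
  rcases le_total (1 / 2) |ρ.im| with h | h
  · have key : ∀ z w : ℂ, ‖z‖ = Real.exp |ρ.im| → ‖w‖ = Real.exp (-|ρ.im|) →
        Real.exp |ρ.im| / 4 ≤ ‖(z + w) / 2‖ := fun z w hz hw => by
      have h1 := norm_sub_norm_le z (-w)
      rw [sub_neg_eq_add, norm_neg, hz, hw] at h1
      rw [norm_div, Complex.norm_two]
      have h2 : 2 * Real.exp (-|ρ.im|) ≤ Real.exp |ρ.im| := by
        have h3 : Real.exp |ρ.im| = Real.exp (2 * |ρ.im|) * Real.exp (-|ρ.im|) := by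
          rw [← Real.exp_add]; ring_nf
        rw [h3]
        gcongr
        linarith [Real.add_one_le_exp (2 * |ρ.im|)]
      linarith
    have n1 : ‖Complex.exp (ρ * Complex.I)‖ = Real.exp (-ρ.im) := by simp [Complex.norm_exp]
    have n2 : ‖Complex.exp (-ρ * Complex.I)‖ = Real.exp ρ.im := by simp [Complex.norm_exp]
    rw [Complex.cos]
    rcases le_total 0 ρ.im with h0 | h0
    · rw [add_comm]
      exact key _ _ (by rw [n2, abs_of_nonneg h0]) (by rw [n1, abs_of_nonneg h0])
    · exact key _ _ (by rw [n1, abs_of_nonpos h0]) (by rw [n2, abs_of_nonpos h0, neg_neg])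
  · have hre : |Real.cos ρ.re| ≤ ‖Complex.cos ρ‖ := by
      refine le_trans ?_ (Complex.abs_re_le_norm _)
      have e : (Complex.cos ρ).re = Real.cos ρ.re * Real.cosh ρ.im := by
        rw [Complex.cos_eq, ← Complex.ofReal_cos, ← Complex.ofReal_cosh, ← Complex.ofReal_sin,
          ← Complex.ofReal_sinh]
        simp [Complex.cos_ofReal_re]
      rw [e, abs_mul, abs_of_pos (Real.cosh_pos _)]
      exact le_mul_of_one_le_right (abs_nonneg _) (Real.one_le_cosh _)
    have hN' : (1 : ℝ) ≤ N := by exact_mod_cast hN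
    have hpi := Real.pi_gt_three
    set d := N * Real.pi - |ρ.re| with hd
    have hsq : ρ.re ^ 2 + ρ.im ^ 2 = (N * Real.pi) ^ 2 := by
      rw [← hρ, ← Complex.normSq_eq_norm_sq, Complex.normSq_apply]; ring
    have him : ρ.im ^ 2 ≤ 1 / 4 := by
      rw [← sq_abs]; nlinarith [abs_nonneg ρ.im]
    have hd2 : d * (N * Real.pi + |ρ.re|) = ρ.im ^ 2 := by
      rw [hd]; linear_combination -hsq - sq_abs ρ.re
    have hNpi : 3 ≤ N * Real.pi := by nlinarith
    have hd0 : 0 ≤ d := by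
      by_contra hneg
      nlinarith [abs_nonneg ρ.re, sq_nonneg ρ.im]
    have hd1 : d ≤ 1 / 12 := by nlinarith [abs_nonneg ρ.re]
    have hcos : |Real.cos ρ.re| = |Real.cos d| := by
      rw [hd, Real.cos_nat_mul_pi_sub, abs_mul, abs_pow, abs_neg, abs_one, one_pow, one_mul,
        Real.cos_abs]
    have h1 : 1 / 2 ≤ |Real.cos ρ.re| := by
      rw [hcos]
      refine le_trans ?_ (le_abs_self _)
      nlinarith [Real.one_sub_sq_div_two_le_cos (x := d)]
    have h2 : Real.exp |ρ.im| ≤ 2 := by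
      have h3 : Real.exp |ρ.im| ≤ Real.exp (1 / 2) := Real.exp_le_exp.2 h
      have h4 : Real.exp (1 / 2) * Real.exp (1 / 2) = Real.exp 1 := by
        rw [← Real.exp_add]; norm_num
      nlinarith [Real.exp_one_lt_d9, Real.exp_pos (1 / 2)]
    linarith

/-- The entire function `lam ↦ cos √lam`. -/
noncomputable def cosSqrt : ℂ → ℂ := charFun (fun _ => 0) 0 0 1

lemma differentiable_cosSqrt : Differentiable ℂ cosSqrt :=
  differentiable_charFun continuousOn_const 0 0 (right_mem_Icc.2 zero_le_one)

lemma cosSqrt_sq (ρ : ℂ) : cosSqrt (ρ ^ 2) = Complex.cos ρ := by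
  have h : (fun ρ : ℂ => cosSqrt (ρ ^ 2)) = Complex.cos := by
    refine Continuous.ext_on (dense_compl_singleton (0 : ℂ))
      (differentiable_cosSqrt.continuous.comp (by fun_prop)) Complex.continuous_cos fun ρ hρ => ?_
    have h1 := norm_charFun_sub_cos_le (q := fun _ => 0) (K := 0) continuousOn_const (by simp) 0 0
      (ξ := 1) (right_mem_Icc.2 zero_le_one) (ρ := ρ) hρ (by simp)
    simp only [abs_zero, add_zero, zero_mul, norm_le_zero_iff] at h1
    exact sub_eq_zero.1 h1
  exact congrFun h ρ

/-- The numbers `(n + 1/2) π`. -/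
noncomputable def halfPi (n : ℕ) : ℝ := (n + 1 / 2) * Real.pi

lemma halfPi_pos (n : ℕ) : 0 < halfPi n := by
  have := Real.pi_pos
  unfold halfPi; positivity

lemma halfPi_injective : Function.Injective halfPi := fun a b h => by
  have := mul_right_cancel₀ Real.pi_pos.ne' h
  exact_mod_cast add_right_cancel this

lemma cos_halfPi_add (n : ℕ) (δ : ℝ) : Real.cos (halfPi n + δ) = -((-1) ^ n * Real.sin δ) := by
  rw [show halfPi n + δ = (δ + Real.pi / 2) + n * Real.pi by unfold halfPi; ring,
    Real.cos_add_nat_mul_pi, Real.cos_add_pi_div_two]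
  ring

lemma sin_halfPi_add (n : ℕ) (δ : ℝ) : Real.sin (halfPi n + δ) = (-1) ^ n * Real.cos δ := by
  rw [show halfPi n + δ = (δ + Real.pi / 2) + n * Real.pi by unfold halfPi; ring,
    Real.sin_add_nat_mul_pi, Real.sin_add_pi_div_two]

lemma exists_eq_halfPi_sq {z : ℂ} (hz : cosSqrt z = 0) : ∃ n : ℕ, z = (halfPi n : ℂ) ^ 2 := by
  obtain ⟨ρ, rfl⟩ := IsAlgClosed.exists_pow_nat_eq z two_pos
  rw [cosSqrt_sq, Complex.cos_eq_zero_iff] at hz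
  obtain ⟨k, rfl⟩ := hz
  rcases le_or_gt 0 k with hk | hk
  · lift k to ℕ using hk
    refine ⟨k, ?_⟩
    simp only [halfPi]; push_cast; ring
  · obtain ⟨m, hm⟩ : ∃ m : ℕ, k = -(m : ℤ) - 1 := ⟨(-k - 1).toNat, by omega⟩
    refine ⟨m, ?_⟩
    rw [hm]
    simp only [halfPi]; push_cast; ring

lemma analyticOrderAt_cosSqrt (n : ℕ) : analyticOrderAt cosSqrt ((halfPi n : ℂ) ^ 2) = 1 := by
  refine (differentiable_cosSqrt.analyticAt _).analyticOrderAt_eq_one_of_zero_deriv_ne_zero ?_ ?_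
  · rw [cosSqrt_sq, ← Complex.ofReal_cos]
    have := cos_halfPi_add n 0
    simp only [add_zero, Real.sin_zero, mul_zero, neg_zero] at this
    rw [this, Complex.ofReal_zero]
  · intro h0
    have h1 : HasDerivAt (fun ρ : ℂ => cosSqrt (ρ ^ 2)) 0 (halfPi n : ℂ) := by
      have h2 := (differentiable_cosSqrt ((halfPi n : ℂ) ^ 2)).hasDerivAt
      rw [h0] at h2
      have := h2.comp (halfPi n : ℂ) (hasDerivAt_pow 2 (halfPi n : ℂ))
      rwa [zero_mul] at this
    rw [show (fun ρ : ℂ => cosSqrt (ρ ^ 2)) = Complex.cos from funext cosSqrt_sq] at h1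
    have h3 := h1.unique (Complex.hasDerivAt_cos _)
    rw [← Complex.ofReal_sin] at h3
    have h4 := sin_halfPi_add n 0
    rw [add_zero, Real.cos_zero, mul_one] at h4
    rw [h4] at h3
    simp at h3

lemma card_filter_halfPi_sq (N : ℕ) {z : ℂ}
    (hz : z ∈ Metric.closedBall (0 : ℂ) ((N * Real.pi) ^ 2)) :
    ((((Finset.range N).filter fun i => (halfPi i : ℂ) ^ 2 = z).card : ℕ) : ℕ∞) =
      analyticOrderAt cosSqrt z := by
  have hinj : ∀ i j, (halfPi i : ℂ) ^ 2 = (halfPi j : ℂ) ^ 2 → i = j := fun i j h => by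
    have h1 : halfPi i ^ 2 = halfPi j ^ 2 := by exact_mod_cast h
    exact halfPi_injective ((sq_eq_sq₀ (halfPi_pos i).le (halfPi_pos j).le).1 h1)
  by_cases h : cosSqrt z = 0
  · obtain ⟨n, rfl⟩ := exists_eq_halfPi_sq h
    have hn : n < N := by
      rw [mem_closedBall_zero_iff, norm_pow, Complex.norm_real, Real.norm_eq_abs,
        abs_of_pos (halfPi_pos n)] at hz
      have h1 : halfPi n ≤ N * Real.pi :=
        (sq_le_sq₀ (halfPi_pos n).le (by positivity)).1 hz
      have h2 : (n : ℝ) + 1 / 2 ≤ N := le_of_mul_le_mul_right h1 Real.pi_pos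
      exact_mod_cast (by linarith : (n : ℝ) < N)
    rw [analyticOrderAt_cosSqrt, show ((Finset.range N).filter fun i =>
      (halfPi i : ℂ) ^ 2 = (halfPi n : ℂ) ^ 2) = {n} from ?_]
    · simp
    · ext i
      simp only [Finset.mem_filter, Finset.mem_range, Finset.mem_singleton]
      constructor
      · exact fun hi => hinj _ _ hi.2
      · rintro rfl; exact ⟨hn, rfl⟩
  · rw [((differentiable_cosSqrt.analyticAt z).analyticOrderAt_eq_zero).2 h,
      Finset.filter_eq_empty_iff.2 fun i _ hi => h ?_]
    · simp
    · exact apply_eq_zero_of_analyticOrderAt_ne_zero (𝕜 := ℂ)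
        (by rw [← hi, analyticOrderAt_cosSqrt]; exact one_ne_zero)

lemma im_charFun (hq : ContinuousOn q (Icc 0 1)) (H γ : ℝ) {ξ : ℝ} (hξ : ξ ∈ Icc (0 : ℝ) 1)
    (ρ : ℝ) : (charFun q H γ ξ ((ρ : ℂ) ^ 2)).im = 0 := by
  have h1 : (1 : ℝ) ∈ Icc (0 : ℝ) 1 := right_mem_Icc.2 zero_le_one
  simp [charFun, im_derivWithin_S_sq hq ρ h1, im_S_sq hq ρ h1, im_S_sq hq ρ hξ]

/-- All large eigenvalues are real, `Λ n = ρ²` with `n π < ρ < (n + 1) π`. -/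
theorem exists_eigenvalue_eq_sq (hq : ContinuousOn q (Icc 0 1)) {H γ ξ : ℝ}
    (hξ : ξ ∈ Icc (0 : ℝ) 1) {Λ : ℕ → ℂ} (hΛ : IsEigenvalueSeq q H γ ξ Λ) :
    ∃ n₀ : ℕ, ∀ n ≥ n₀, ∃ ρ : ℝ, n * Real.pi < ρ ∧ ρ < (n + 1) * Real.pi ∧
      Λ n = (ρ : ℂ) ^ 2 ∧ charFun q H γ ξ ((ρ : ℂ) ^ 2) = 0 := by
  obtain ⟨K, hK⟩ := exists_abs_le_of_continuousOn hq
  have hK0 : 0 ≤ K := (abs_nonneg _).trans (hK 0 (left_mem_Icc.2 zero_le_one))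
  have hpi := Real.pi_gt_three
  set B := K + |H| + |γ| with hB
  have hB0 : 0 ≤ B := by positivity
  obtain ⟨n₀, hn₀⟩ := exists_nat_gt (8 * B + 2 * K + 1)
  have hbig : ∀ n ≥ n₀, 8 * B + 2 * K + 1 < n * Real.pi := fun n hn => by
    have h1 : (n₀ : ℝ) ≤ n := by exact_mod_cast hn
    nlinarith
  have hone : ∀ n ≥ n₀, 1 ≤ n := fun n hn => by
    by_contra h0
    have : n = 0 := by omega
    have := hbig n hn
    simp_all
    linarith
  have hclose : ∀ n ≥ n₀, ∀ ρ : ℂ, ‖ρ‖ = n * Real.pi →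
      ‖charFun q H γ ξ (ρ ^ 2) - Complex.cos ρ‖ < ‖Complex.cos ρ‖ := fun n hn ρ hρ => by
    have hb := hbig n hn
    have hpos : 0 < ‖ρ‖ := by rw [hρ]; linarith
    have h1 := norm_charFun_sub_cos_le hq hK H γ hξ (ρ := ρ) (norm_pos_iff.1 hpos)
      (by rw [hρ]; linarith)
    refine (h1.trans_lt ?_).trans_le (exp_div_four_le_norm_cos (hone n hn) hρ)
    rw [mul_comm, div_eq_mul_inv (Real.exp _)]
    refine mul_lt_mul_of_pos_left ?_ (Real.exp_pos _)
    rw [mul_div, div_lt_iff₀ hpos, hρ]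
    linarith
  set f := charFun q H γ ξ with hf
  have hfd : Differentiable ℂ f := differentiable_charFun hq H γ hξ
  have hcount : ∀ n ≥ n₀, ∀ k, ‖Λ k‖ < (n * Real.pi) ^ 2 ↔ k < n := fun n hn => by
    have hb := hbig n hn
    have hR : 0 < (n * Real.pi) ^ 2 := pow_pos (by linarith) 2
    obtain ⟨s, hs, hcard⟩ := ncard_norm_lt_eq_of_norm_sub_lt hR hfd differentiable_cosSqrt
      (fun z hz => by
        obtain ⟨ρ, rfl⟩ := IsAlgClosed.exists_pow_nat_eq z two_pos
        rw [cosSqrt_sq]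
        refine hclose n hn ρ ?_
        rw [mem_sphere_zero_iff_norm, norm_pow] at hz
        exact (sq_eq_sq₀ (norm_nonneg _) (by linarith)).1 hz)
      hΛ.multiplicity (Λ₀ := fun i => (halfPi i : ℂ) ^ 2) (s₀ := Finset.range n)
      (fun i hi => by
        have h1 : (i : ℝ) + 1 ≤ n := by exact_mod_cast Finset.mem_range.1 hi
        rw [mem_ball_zero_iff, norm_pow, Complex.norm_real, Real.norm_eq_abs,
          abs_of_pos (halfPi_pos i)]
        refine pow_lt_pow_left₀ ?_ (halfPi_pos i).le two_ne_zero
        unfold halfPi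
        nlinarith)
      (fun z hz => card_filter_halfPi_sq n hz)
    rw [Finset.card_range] at hcard
    have hlow : ∀ k ∈ s, ∀ l ≤ k, l ∈ s := fun k hk l hl =>
      (hs l).2 ((hΛ.norm_mono hl).trans_lt ((hs k).1 hk))
    have hsr : s = Finset.range n := by
      refine Finset.eq_of_subset_of_card_le (fun k hk => ?_) (by rw [Finset.card_range, hcard])
      have h1 : Finset.range (k + 1) ⊆ s := fun l hl =>
        hlow k hk l (by rw [Finset.mem_range] at hl; omega)
      have h2 := Finset.card_le_card h1
      rw [Finset.card_range, hcard] at h2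
      exact Finset.mem_range.2 h2
    intro k
    rw [← hs, hsr, Finset.mem_range]
  refine ⟨n₀, fun n hn => ?_⟩
  set ψ : ℝ → ℝ := fun ρ => (-1) ^ n * (f ((ρ : ℂ) ^ 2)).re with hψ
  have hψc : Continuous ψ := by
    have := hfd.continuous
    fun_prop
  have hend : ∀ m ≥ n₀, |(f (((m * Real.pi : ℝ) : ℂ) ^ 2)).re - (-1) ^ m| < 1 := fun m hm => by
    have h1 := hclose m hm ((m * Real.pi : ℝ) : ℂ) (by
      rw [Complex.norm_real, Real.norm_eq_abs, abs_of_nonneg (by positivity)])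
    rw [← Complex.ofReal_cos, Real.cos_nat_mul_pi] at h1
    have h2 := (Complex.abs_re_le_norm _).trans_lt h1
    rw [Complex.sub_re, Complex.ofReal_re, Complex.norm_real] at h2
    simpa using h2
  have hψ1 : 0 ≤ ψ (n * Real.pi) := by
    have h1 := abs_lt.1 (hend n hn)
    simp only [hψ]
    rcases neg_one_pow_eq_or ℝ n with h | h <;> rw [h] at h1 ⊢ <;> linarith
  have hψ2 : ψ ((n + 1 : ℕ) * Real.pi) ≤ 0 := by
    have h1 := abs_lt.1 (hend (n + 1) (by omega))
    rw [pow_succ (-1 : ℝ)] at h1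
    simp only [hψ]
    rcases neg_one_pow_eq_or ℝ n with h | h <;> rw [h] at h1 ⊢ <;> linarith
  obtain ⟨ρ, hρ, hρ0⟩ := intermediate_value_Icc' (f := ψ)
    (a := n * Real.pi) (b := (n + 1 : ℕ) * Real.pi)
    (by push_cast; nlinarith) hψc.continuousOn ⟨hψ2, hψ1⟩
  have hfρ : f ((ρ : ℂ) ^ 2) = 0 := by
    refine Complex.ext ?_ (im_charFun hq H γ hξ ρ)
    exact (mul_eq_zero.1 hρ0).resolve_left (pow_ne_zero _ (by norm_num))
  have hne : ∀ m ≥ n₀, ρ ≠ m * Real.pi := fun m hm e => by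
    have h1 := hclose m hm (ρ : ℂ) (by
      rw [Complex.norm_real, Real.norm_eq_abs, e, abs_of_nonneg (by positivity)])
    rw [hfρ, zero_sub, norm_neg] at h1
    exact lt_irrefl _ h1
  have hρ1 : n * Real.pi < ρ := lt_of_le_of_ne hρ.1 (hne n hn).symm
  have hρ2 : ρ < (n + 1 : ℕ) * Real.pi := lt_of_le_of_ne hρ.2 (hne (n + 1) (by omega))
  obtain ⟨k, hk⟩ : {k | Λ k = (ρ : ℂ) ^ 2}.Nonempty := by
    rw [← Set.encard_ne_zero, hΛ.multiplicity]
    exact ((hfd.analyticAt _).analyticOrderAt_ne_zero).2 hfρ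
  have hk' : Λ k = (ρ : ℂ) ^ 2 := hk
  have hρpos : 0 < ρ := by linarith [hbig n hn]
  have hnorm : ‖Λ k‖ = ρ ^ 2 := by
    rw [hk', norm_pow, Complex.norm_real, Real.norm_eq_abs, abs_of_pos hρpos]
  have hk1 : ¬ k < n := by
    rw [← hcount n hn, hnorm, not_lt]
    exact pow_le_pow_left₀ (by positivity) hρ1.le 2
  have hk2 : k < n + 1 := by
    rw [← hcount (n + 1) (by omega), hnorm]
    exact pow_lt_pow_left₀ hρ2 hρpos.le two_ne_zero
  have hkn : k = n := by omega
  rw [hkn] at hk'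
  exact ⟨ρ, hρ1, by push_cast at hρ2; exact hρ2, hk', hfρ⟩

/-- The characteristic equation for large real `ρ`, up to `O(1/ρ²)`. -/
lemma exists_abs_charEq_le (hq : ContDiffOn ℝ 1 q (Icc 0 1)) (hq0 : ∫ x in (0 : ℝ)..1, q x = 0)
    (H γ : ℝ) {ξ : ℝ} (hξ : ξ ∈ Icc (0 : ℝ) 1) :
    ∃ C ρ₀ : ℝ, 0 ≤ C ∧ ∀ ρ : ℝ, ρ₀ ≤ ρ → charFun q H γ ξ ((ρ : ℂ) ^ 2) = 0 →
      |ρ * Real.cos ρ + H * Real.sin ρ - γ * Real.sin (ρ * ξ)| ≤ C / ρ := by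
  obtain ⟨K, hK⟩ := exists_abs_le_of_continuousOn hq.continuousOn
  have hK0 : 0 ≤ K := (abs_nonneg _).trans (hK 0 (left_mem_Icc.2 zero_le_one))
  obtain ⟨C, ρ₀, hρ₀, hC⟩ := exists_norm_amplitude_sub_le hq
  have h1 : (1 : ℝ) ∈ Icc (0 : ℝ) 1 := right_mem_Icc.2 zero_le_one
  refine ⟨|C| + |H| * (K * 2) + |γ| * (K * 2), max ρ₀ (2 * K + 1), by positivity,
    fun ρ hρ hΔ => ?_⟩
  have hρ1 : ρ₀ ≤ ρ := (le_max_left _ _).trans hρ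
  have hρ2 : 2 * K + 1 ≤ ρ := (le_max_right _ _).trans hρ
  have hρ0 : 0 < ρ := by linarith
  have hdiff : ∀ x : ℝ, (amplitude q (Complex.I * ρ) x - 1) *
      Complex.exp ((ρ * x : ℝ) * Complex.I) =
      derivWithin (S q ((ρ : ℂ) ^ 2)) (Icc 0 1) x + Complex.I * ρ * S q ((ρ : ℂ) ^ 2) x -
        Complex.exp ((ρ * x : ℝ) * Complex.I) := fun x => by
    rw [sub_one_mul, amplitude_mul_exp_real]
  have hnorm : ∀ x : ℝ, ‖derivWithin (S q ((ρ : ℂ) ^ 2)) (Icc 0 1) x +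
      Complex.I * ρ * S q ((ρ : ℂ) ^ 2) x - Complex.exp ((ρ * x : ℝ) * Complex.I)‖ =
      ‖amplitude q (Complex.I * ρ) x - 1‖ := fun x => by
    rw [← hdiff, norm_mul, Complex.norm_exp_ofReal_mul_I, mul_one]
  have hS : ∀ x ∈ Icc (0 : ℝ) 1,
      |ρ * (S q ((ρ : ℂ) ^ 2) x).re - Real.sin (ρ * x)| ≤ K * (2 / ρ) := fun x hx => by
    have h := (Complex.abs_im_le_norm _).trans ((hnorm x).le.trans
      (amplitude_bound_of_real hq.continuousOn hK hρ0 (by linarith) (Or.inl rfl) hx))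
    rw [Complex.sub_im, Complex.exp_ofReal_mul_I_im, Complex.add_im,
      im_derivWithin_S_sq hq.continuousOn ρ hx] at h
    simpa using h
  have hD : |(derivWithin (S q ((ρ : ℂ) ^ 2)) (Icc 0 1) 1).re - Real.cos ρ| ≤ C / ρ ^ 2 := by
    have h2 := hC ρ hρ1 1 h1
    rw [hq0, Complex.ofReal_zero, zero_div, sub_zero] at h2
    have h := (Complex.abs_re_le_norm _).trans ((hnorm 1).le.trans h2)
    rw [Complex.sub_re, Complex.exp_ofReal_mul_I_re, Complex.add_re, mul_one] at h
    simpa [im_S_sq hq.continuousOn ρ h1] using h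
  have hre : (derivWithin (S q ((ρ : ℂ) ^ 2)) (Icc 0 1) 1).re + H * (S q ((ρ : ℂ) ^ 2) 1).re -
      γ * (S q ((ρ : ℂ) ^ 2) ξ).re = 0 := by
    have := congrArg Complex.re hΔ
    simpa [charFun] using this
  set d := (derivWithin (S q ((ρ : ℂ) ^ 2)) (Icc 0 1) 1).re
  set s1 := (S q ((ρ : ℂ) ^ 2) 1).re
  set sξ := (S q ((ρ : ℂ) ^ 2) ξ).re
  have hS1 := hS 1 h1
  have hSξ := hS ξ hξ
  rw [mul_one] at hS1
  have hid : ρ * Real.cos ρ + H * Real.sin ρ - γ * Real.sin (ρ * ξ) =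
      -(ρ * (d - Real.cos ρ)) - H * (ρ * s1 - Real.sin ρ) + γ * (ρ * sξ - Real.sin (ρ * ξ)) := by
    linear_combination ρ * hre
  rw [hid]
  calc _ ≤ |ρ * (d - Real.cos ρ)| + |H * (ρ * s1 - Real.sin ρ)| +
        |γ * (ρ * sξ - Real.sin (ρ * ξ))| := by
        refine (abs_add_le _ _).trans (add_le_add ((abs_sub _ _).trans ?_) le_rfl)
        rw [abs_neg]
    _ ≤ ρ * (|C| / ρ ^ 2) + |H| * (K * (2 / ρ)) + |γ| * (K * (2 / ρ)) := by
        rw [abs_mul, abs_mul, abs_mul, abs_of_pos hρ0]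
        gcongr
        exact hD.trans (by gcongr; exact le_abs_self _)
    _ = _ := by field_simp

/-- Solving the asymptotic characteristic equation near `(n + 1/2) π`. -/
lemma abs_halfPi_mul_sub_le {C H γ ξ : ℝ} (hξ : ξ ∈ Icc (0 : ℝ) 1) (hC : 0 ≤ C)
    (n : ℕ) {ρ δ : ℝ} (hρ : ρ = halfPi n + δ) (hρ1 : 1 ≤ ρ) (hδ : |δ| ≤ Real.pi / 2)
    (h : |ρ * Real.cos ρ + H * Real.sin ρ - γ * Real.sin (ρ * ξ)| ≤ C / ρ) :
    |δ| ≤ 2 * (C + |H| + |γ|) / ρ ∧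
    |halfPi n * δ - (H - (-1) ^ n * γ * Real.sin (halfPi n * ξ))| ≤
      (2 * (2 * (C + |H| + |γ|)) ^ 2 + C + 2 * (C + |H| + |γ|) * (|H| + |γ|)) / ρ := by
  set A := C + |H| + |γ| with hA
  have hA0 : 0 ≤ A := by positivity
  have hρ0 : 0 < ρ := by linarith
  have hsq : ((-1 : ℝ) ^ n) * (-1) ^ n = 1 := by rw [← mul_pow]; simp
  have habs : |(-1 : ℝ) ^ n| = 1 := by simp
  have h1 : |ρ * Real.sin δ - H * Real.cos δ + (-1) ^ n * γ * Real.sin (ρ * ξ)| ≤ C / ρ := by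
    have e : ρ * Real.sin δ - H * Real.cos δ + (-1) ^ n * γ * Real.sin (ρ * ξ) =
        -((-1) ^ n * (ρ * Real.cos ρ + H * Real.sin ρ - γ * Real.sin (ρ * ξ))) := by
      have hc : Real.cos ρ = -((-1) ^ n * Real.sin δ) := by rw [hρ, cos_halfPi_add]
      have hs : Real.sin ρ = (-1) ^ n * Real.cos δ := by rw [hρ, sin_halfPi_add]
      rw [hc, hs]
      linear_combination (-ρ * Real.sin δ + H * Real.cos δ) * hsq
    rw [e, abs_neg, abs_mul, habs, one_mul]
    exact h
  have hCρ : C / ρ ≤ C := div_le_self hC hρ1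
  have h2 : |ρ * Real.sin δ| ≤ A := by
    have hb1 : |H * Real.cos δ| ≤ |H| := by
      rw [abs_mul]; exact mul_le_of_le_one_right (abs_nonneg _) (Real.abs_cos_le_one _)
    have hb2 : |(-1) ^ n * γ * Real.sin (ρ * ξ)| ≤ |γ| := by
      rw [abs_mul, abs_mul, habs, one_mul]
      exact mul_le_of_le_one_right (abs_nonneg _) (Real.abs_sin_le_one _)
    rw [abs_le] at h1 hb1 hb2 ⊢
    constructor <;> linarith
  have h3 : |δ| ≤ 2 * A / ρ := by
    rw [le_div_iff₀ hρ0]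
    rw [abs_mul, abs_of_pos hρ0] at h2
    have h4 := Real.mul_abs_le_abs_sin hδ
    have h5 : 1 / 2 * |δ| ≤ |Real.sin δ| := by
      refine le_trans ?_ h4
      refine mul_le_mul_of_nonneg_right ?_ (abs_nonneg _)
      rw [div_le_div_iff₀ two_pos Real.pi_pos]
      linarith [Real.pi_le_four]
    nlinarith
  refine ⟨h3, ?_⟩
  have hsin : |Real.sin δ - δ| ≤ δ ^ 2 := by
    have key : ∀ t : ℝ, 0 ≤ t → t ≤ 2 → |Real.sin t - t| ≤ t ^ 2 := fun t ht ht2 => by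
      rw [abs_le]
      constructor
      · have := Real.sin_ge_sub_cube ht
        nlinarith [mul_nonneg (sq_nonneg t) ht, mul_nonneg (sq_nonneg t) (by linarith : 0 ≤ 6 - t)]
      · nlinarith [Real.sin_le ht]
    have h2 : |δ| ≤ 2 := hδ.trans (by linarith [Real.pi_le_four])
    rcases le_total 0 δ with hd | hd
    · exact key δ hd (by rwa [abs_of_nonneg hd] at h2)
    · have := key (-δ) (by linarith) (by rwa [abs_of_nonpos hd] at h2)
      rw [Real.sin_neg, neg_sq] at this
      rwa [show -Real.sin δ - -δ = -(Real.sin δ - δ) by ring, abs_neg] at this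
  have hcos : |1 - Real.cos δ| ≤ |δ| := by
    have := Real.one_sub_sq_div_two_le_cos (x := δ)
    have h2 : |δ| ≤ 2 := hδ.trans (by linarith [Real.pi_le_four])
    rw [abs_of_nonneg (by linarith [Real.cos_le_one δ])]
    nlinarith [abs_nonneg δ, sq_abs δ]
  have hsinξ : |Real.sin (ρ * ξ) - Real.sin (halfPi n * ξ)| ≤ |δ| := by
    refine (Real.abs_sin_sub_sin_le _ _).trans ?_
    rw [hρ, ← sub_mul, add_sub_cancel_left, abs_mul, abs_of_nonneg hξ.1]
    exact mul_le_of_le_one_right (abs_nonneg _) hξ.2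
  have hδ2 : δ ^ 2 ≤ (2 * A) ^ 2 / ρ / ρ := by
    rw [← sq_abs]
    calc |δ| ^ 2 ≤ (2 * A / ρ) ^ 2 := by gcongr
      _ = _ := by field_simp
  have hid : halfPi n * δ - (H - (-1) ^ n * γ * Real.sin (halfPi n * ξ)) =
      (ρ * Real.sin δ - H * Real.cos δ + (-1) ^ n * γ * Real.sin (ρ * ξ)) -
      ρ * (Real.sin δ - δ) - δ ^ 2 - H * (1 - Real.cos δ) -
      (-1) ^ n * γ * (Real.sin (ρ * ξ) - Real.sin (halfPi n * ξ)) := by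
    rw [hρ]; ring
  rw [hid]
  have b1 : |ρ * (Real.sin δ - δ)| ≤ (2 * A) ^ 2 / ρ := by
    rw [abs_mul, abs_of_pos hρ0]
    calc _ ≤ ρ * ((2 * A) ^ 2 / ρ / ρ) := by gcongr; exact hsin.trans hδ2
      _ = _ := by field_simp
  have b2 : |δ ^ 2| ≤ (2 * A) ^ 2 / ρ := by
    rw [abs_of_nonneg (sq_nonneg δ)]
    exact hδ2.trans (div_le_self (by positivity) hρ1)
  have b3 : |H * (1 - Real.cos δ)| ≤ |H| * (2 * A / ρ) := by
    rw [abs_mul]; gcongr; exact hcos.trans h3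
  have b4 : |(-1) ^ n * γ * (Real.sin (ρ * ξ) - Real.sin (halfPi n * ξ))| ≤
      |γ| * (2 * A / ρ) := by
    rw [abs_mul, abs_mul, habs, one_mul]; gcongr; exact hsinξ.trans h3
  have hsum : (2 * (2 * A) ^ 2 + C + 2 * A * (|H| + |γ|)) / ρ =
      C / ρ + (2 * A) ^ 2 / ρ + (2 * A) ^ 2 / ρ + |H| * (2 * A / ρ) + |γ| * (2 * A / ρ) := by ring
  rw [hsum]
  rw [abs_le] at h1 b1 b2 b3 b4 ⊢
  constructor <;> linarith

/-- The coefficient `(-1)ⁿ γ sin((n + 1/2) π ξ) - H` in the asymptotics of the nodes. -/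
noncomputable def nodeShift (H γ ξ : ℝ) (n : ℕ) : ℝ :=
  (-1) ^ n * γ * Real.sin (halfPi n * ξ) - H

/-- The asymptotics of the nodes, uniform in `j`. -/
theorem exists_abs_node_sub_le (hq : ContDiffOn ℝ 1 q (Icc 0 1))
    (hq0 : ∫ x in (0 : ℝ)..1, q x = 0) {H γ ξ : ℝ} (hξ : ξ ∈ Icc (0 : ℝ) 1) {Λ : ℕ → ℂ}
    (hΛ : IsEigenvalueSeq q H γ ξ Λ) :
    ∃ (C : ℝ) (n₀ : ℕ), ∀ n ≥ n₀, ∀ (j : ℕ) (y : ℝ), (n, j, y) ∈ nodalSet q Λ →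
      |((n : ℝ) + 1 / 2) ^ 2 * Real.pi ^ 2 * (y - (j : ℝ) / ((n : ℝ) + 1 / 2)) -
        (y * nodeShift H γ ξ n + (∫ t in (0 : ℝ)..y, q t) / 2)| ≤ C / n := by
  obtain ⟨K, hK⟩ := exists_abs_le_of_continuousOn hq.continuousOn
  obtain ⟨C₁, ρ₁, hC₁, h₁⟩ := exists_abs_charEq_le hq hq0 H γ hξ
  obtain ⟨C₂, ρ₂, hC₂, h₂⟩ := exists_abs_mul_arg_add_le hq
  obtain ⟨n₁, hn₁⟩ := exists_eigenvalue_eq_sq hq.continuousOn hξ hΛ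
  obtain ⟨n₂, hn₂⟩ := exists_nat_gt (max (max ρ₁ ρ₂) (max 1 (4 * K + 2)))
  set A := C₁ + |H| + |γ| with hA
  have hA0 : 0 ≤ A := by positivity
  set B := 2 * (2 * A) ^ 2 + C₁ + 2 * A * (|H| + |γ|) with hB
  have hB0 : 0 ≤ B := by positivity
  refine ⟨B + C₂ + 2 * A * Real.pi, max n₁ n₂, fun n hn j y hy => ?_⟩
  obtain ⟨ρ, hρl, hρu, hΛn, hchar⟩ := hn₁ n ((le_max_left _ _).trans hn)
  have hn2 : (n₂ : ℝ) ≤ n := by exact_mod_cast (le_max_right _ _).trans hn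
  have hnbig := hn₂.trans_le hn2
  rw [max_lt_iff, max_lt_iff, max_lt_iff] at hnbig
  obtain ⟨⟨hb1, hb2⟩, hb3, hb4⟩ := hnbig
  have hpi := Real.pi_gt_three
  have hnρ : (n : ℝ) ≤ ρ := by nlinarith
  have hn0 : (0 : ℝ) < n := by linarith
  have hρ0 : 0 < ρ := by linarith
  set δ := ρ - halfPi n with hδdef
  have hρδ : ρ = halfPi n + δ := by rw [hδdef]; ring
  have hδ : |δ| ≤ Real.pi / 2 := by
    rw [abs_le, hδdef]
    unfold halfPi
    constructor <;> nlinarith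
  obtain ⟨hd1, hd2⟩ := abs_halfPi_mul_sub_le hξ hC₁ n hρδ (by linarith) hδ
    (h₁ ρ (by linarith) hchar)
  obtain ⟨hynode, hyj⟩ := hy
  simp only at hynode hyj
  rw [hΛn] at hynode hyj
  have hy01 : y ∈ Icc (0 : ℝ) 1 := ⟨hynode.1.1.le, hynode.1.2.le⟩
  have hphase := phase_eq_of_index hq.continuousOn hK (by linarith) hynode hyj
  have harg := h₂ ρ (by linarith) y hy01
  rw [phase] at hphase
  set α := (amplitude q (Complex.I * ρ) y).arg
  set Q := ∫ t in (0 : ℝ)..y, q t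
  have hid : ((n : ℝ) + 1 / 2) ^ 2 * Real.pi ^ 2 * (y - (j : ℝ) / ((n : ℝ) + 1 / 2)) -
      (y * nodeShift H γ ξ n + Q / 2) =
      -(y * (halfPi n * δ - (H - (-1) ^ n * γ * Real.sin (halfPi n * ξ)))) -
        (ρ * α + Q / 2) + δ * α := by
    have e : ((n : ℝ) + 1 / 2) ^ 2 * Real.pi ^ 2 * (y - (j : ℝ) / ((n : ℝ) + 1 / 2)) =
        halfPi n * (halfPi n * y - j * Real.pi) := by
      unfold halfPi; field_simp
    rw [e, ← hphase, nodeShift, hρδ]; ring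
  have b1 : |y * (halfPi n * δ - (H - (-1) ^ n * γ * Real.sin (halfPi n * ξ)))| ≤ B / ρ := by
    rw [abs_mul, abs_of_nonneg hy01.1]
    exact (mul_le_of_le_one_left (abs_nonneg _) hy01.2).trans hd2
  have b2 : |δ * α| ≤ 2 * A / ρ * Real.pi := by
    rw [abs_mul]
    gcongr
    exact Complex.abs_arg_le_pi _
  rw [hid]
  calc _ ≤ B / ρ + C₂ / ρ + 2 * A / ρ * Real.pi := by
        rw [abs_le] at b1 b2 harg ⊢
        constructor <;> linarith
    _ = (B + C₂ + 2 * A * Real.pi) / ρ := by ring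
    _ ≤ _ := by gcongr

lemma nodeShift_add_mul {p r : ℕ} (hr : 0 < r) (H γ : ℝ) {ξ : ℝ} (hξ : ξ = (p : ℝ) / r)
    (n i : ℕ) : nodeShift H γ ξ (2 * r * n + i) = nodeShift H γ ξ i := by
  have h1 : halfPi (2 * r * n + i) * ξ = halfPi i * ξ + (n * p : ℕ) * (2 * Real.pi) := by
    have : (r : ℝ) ≠ 0 := by positivity
    rw [hξ]
    unfold halfPi
    push_cast
    field_simp
    ring
  have h2 : ((-1 : ℝ)) ^ (2 * r * n + i) = (-1) ^ i := by
    rw [pow_add, mul_assoc, pow_mul]; simp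
  rw [nodeShift, nodeShift, h1, h2, Real.sin_add_nat_mul_two_pi]

/-- The limit of the scaled deviations of the nodes along the indices `2 r n + i`. -/
theorem tendsto_node {p r : ℕ} (hr : 0 < r) (hq : ContDiffOn ℝ 1 q (Icc 0 1))
    (hq0 : ∫ x in (0 : ℝ)..1, q x = 0) {H γ ξ : ℝ} (hξ : ξ = (p : ℝ) / r)
    (hξ' : ξ ∈ Icc (0 : ℝ) 1) {Λ : ℕ → ℂ} (hΛ : IsEigenvalueSeq q H γ ξ Λ) (i : ℕ)
    {x : ℝ} (hx : x ∈ Icc (0 : ℝ) 1) {j : ℕ → ℕ} {y : ℕ → ℝ}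
    (hy : ∀ᶠ n in atTop, (2 * r * n + i, j n, y n) ∈ nodalSet q Λ) (hyx : Tendsto y atTop (𝓝 x)) :
    Tendsto (fun n : ℕ => (((2 * r * n + i : ℕ) : ℝ) + 1 / 2) ^ 2 * Real.pi ^ 2 *
      (y n - (j n : ℝ) / (((2 * r * n + i : ℕ) : ℝ) + 1 / 2))) atTop
      (𝓝 (x * nodeShift H γ ξ i + (∫ t in (0 : ℝ)..x, q t) / 2)) := by
  obtain ⟨C, n₀, hC⟩ := exists_abs_node_sub_le hq hq0 hξ' hΛ
  have hφ : Tendsto (fun n : ℕ => 2 * r * n + i) atTop atTop := by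
    refine tendsto_atTop_mono (fun n => ?_) tendsto_id
    simp only [id]
    nlinarith
  have hlim0 : Tendsto (fun n : ℕ => C / ((2 * r * n + i : ℕ) : ℝ)) atTop (𝓝 0) :=
    (tendsto_const_div_atTop_nhds_zero_nat C).comp hφ
  have hQ : Tendsto (fun n => ∫ t in (0 : ℝ)..y n, q t) atTop (𝓝 (∫ t in (0 : ℝ)..x, q t)) := by
    have h1 := (hasDerivWithinAt_integral hq.continuousOn hx).continuousWithinAt
    refine h1.tendsto.comp (tendsto_nhdsWithin_iff.2 ⟨hyx, ?_⟩)
    filter_upwards [hy] with n hn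
    exact ⟨hn.1.1.1.le, hn.1.1.2.le⟩
  have hmain : Tendsto (fun n => y n * nodeShift H γ ξ i + (∫ t in (0 : ℝ)..y n, q t) / 2) atTop
      (𝓝 (x * nodeShift H γ ξ i + (∫ t in (0 : ℝ)..x, q t) / 2)) :=
    (hyx.mul_const _).add (hQ.div_const 2)
  refine tendsto_of_tendsto_of_dist hmain ?_
  refine squeeze_zero' (Eventually.of_forall fun n => dist_nonneg) ?_ hlim0
  filter_upwards [hy, hφ.eventually_ge_atTop n₀] with n hn hn0
  have := hC _ hn0 _ _ hn
  rw [nodeShift_add_mul hr H γ hξ] at this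
  rwa [dist_comm, Real.dist_eq]

lemma eqOn_of_eqOn_integral {q q' : ℝ → ℝ} (hq : ContinuousOn q (Icc 0 1))
    (hq' : ContinuousOn q' (Icc 0 1))
    (h : ∀ x ∈ Icc (0 : ℝ) 1, ∫ t in (0 : ℝ)..x, q t = ∫ t in (0 : ℝ)..x, q' t) :
    EqOn q q' (Icc 0 1) := fun x hx =>
  (uniqueDiffWithinAt_Icc01 hx).eq_deriv _ (hasDerivWithinAt_integral hq hx)
    ((hasDerivWithinAt_integral hq' hx).congr h (h x hx))

lemma nodeShift_zero (H γ ξ : ℝ) :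
    nodeShift H γ ξ 0 = γ * Real.sin (Real.pi * ξ / 2) - H := by
  simp only [nodeShift, halfPi]
  push_cast
  rw [pow_zero, one_mul, show (0 + 1 / 2) * Real.pi * ξ = Real.pi * ξ / 2 by ring]

lemma nodeShift_one (H γ ξ : ℝ) :
    nodeShift H γ ξ 1 = -(γ * Real.sin (3 * (Real.pi * ξ / 2))) - H := by
  simp only [nodeShift, halfPi]
  push_cast
  rw [show (1 + 1 / 2) * Real.pi * ξ = 3 * (Real.pi * ξ / 2) by ring]
  ring

lemma eq_of_nodeShift_eq {H γ H' γ' ξ : ℝ} (hξ : ξ ∈ Ioo (0 : ℝ) 1)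
    (h0 : nodeShift H γ ξ 0 = nodeShift H' γ' ξ 0)
    (h1 : nodeShift H γ ξ 1 = nodeShift H' γ' ξ 1) : H = H' ∧ γ = γ' := by
  rw [nodeShift_zero, nodeShift_zero] at h0
  rw [nodeShift_one, nodeShift_one] at h1
  have hpi := Real.pi_pos
  set a := Real.pi * ξ / 2 with ha
  have ha0 : 0 < a := by have := hξ.1; positivity
  have ha1 : a < Real.pi / 2 := by
    rw [ha]; have := mul_lt_mul_of_pos_left hξ.2 hpi; linarith
  have hs : 0 < Real.sin a := Real.sin_pos_of_pos_of_lt_pi ha0 (by linarith)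
  have hc : 0 < Real.cos a := Real.cos_pos_of_mem_Ioo ⟨by linarith, ha1⟩
  have hsum : 0 < Real.sin a + Real.sin (3 * a) := by
    have e : Real.sin a + Real.sin (3 * a) = 4 * (Real.sin a * Real.cos a ^ 2) := by
      rw [Real.sin_three_mul, Real.cos_sq']; ring
    rw [e]; positivity
  have hγ : γ = γ' := by
    have : (γ - γ') * (Real.sin a + Real.sin (3 * a)) = 0 := by linear_combination h0 - h1
    exact sub_eq_zero.1 ((mul_eq_zero.1 this).resolve_right hsum.ne')
  exact ⟨by rw [hγ] at h0; linarith, hγ⟩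

end NonlocalSL

theorem theorem2
    (p r : ℕ) (hp : 0 < p) (hpr : p < r) (ξ : ℝ) (hξ : ξ = (p : ℝ) / (r : ℝ))
    (q : ℝ → ℝ) (hq : ContDiffOn ℝ 1 q (Icc 0 1)) (hq0 : ∫ x in (0 : ℝ)..1, q x = 0)
    (H γ : ℝ) (hγ : γ ≠ 0)
    (Λ : ℕ → ℂ) (hΛ : IsEigenvalueSeq q H γ ξ Λ)
    (X₀ : Set (ℕ × ℕ × ℝ)) (hX₀ : X₀ ⊆ nodalSet q Λ) (hX₀d : IsDenseNodalSet X₀) :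
    (∀ (q' : ℝ → ℝ) (H' γ' : ℝ) (Λ' : ℕ → ℂ) (X₀' : Set (ℕ × ℕ × ℝ)),
      ContDiffOn ℝ 1 q' (Icc 0 1) → ∫ x in (0 : ℝ)..1, q' x = 0 → γ' ≠ 0 →
      IsEigenvalueSeq q' H' γ' ξ Λ' → X₀' ⊆ nodalSet q' Λ' → IsDenseNodalSet X₀' →
      X₀ = X₀' →
        (∀ᵐ x ∂(volume.restrict (Ioo (0 : ℝ) 1)), q x = q' x) ∧ H = H' ∧ γ = γ') ∧
    ∃ g : ℝ → ℝ,
      (∀ x ∈ Icc (0 : ℝ) 1, IsNodalLimit X₀ r x (g x)) ∧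
      DifferentiableOn ℝ g (Icc 0 1) ∧
      (∀ x ∈ Icc (0 : ℝ) 1, q x = 2 * (derivWithin g (Icc 0 1) x - g 1)) ∧
      γ * Real.sin (Real.pi * ξ / 2) - H = g 1 := by
  have hr : 0 < r := hp.trans hpr
  have hξ01 : ξ ∈ Ioo (0 : ℝ) 1 := by
    have h1 : (0 : ℝ) < p := by exact_mod_cast hp
    have h2 : (p : ℝ) < r := by exact_mod_cast hpr
    rw [hξ]
    exact ⟨by positivity, (div_lt_one (by linarith)).2 h2⟩
  have hξI : ξ ∈ Icc (0 : ℝ) 1 := ⟨hξ01.1.le, hξ01.2.le⟩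
  have h1 : (1 : ℝ) ∈ Icc (0 : ℝ) 1 := right_mem_Icc.2 zero_le_one
  have hsub : ∀ i, Tendsto (fun n : ℕ => 2 * r * n + i) atTop atTop := fun i => by
    refine tendsto_atTop_mono (fun n => ?_) tendsto_id
    simp only [id]
    nlinarith
  constructor
  · rintro q' H' γ' Λ' X₀' hq' hq0' hγ' hΛ' hX₀' - rfl
    have hlim : ∀ i, ∀ x ∈ Icc (0 : ℝ) 1,
        x * nodeShift H γ ξ i + (∫ t in (0 : ℝ)..x, q t) / 2 =
          x * nodeShift H' γ' ξ i + (∫ t in (0 : ℝ)..x, q' t) / 2 := fun i x hx => by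
      obtain ⟨j, y, hjy, hyx⟩ := hX₀d x hx
      have hmem := (hsub i).eventually hjy
      have hyx' := hyx.comp (hsub i)
      exact tendsto_nhds_unique
        (tendsto_node hr hq hq0 hξ hξI hΛ i hx (hmem.mono fun n hn => hX₀ hn) hyx')
        (tendsto_node hr hq' hq0' hξ hξI hΛ' i hx (hmem.mono fun n hn => hX₀' hn) hyx')
    have hshift : ∀ i, nodeShift H γ ξ i = nodeShift H' γ' ξ i := fun i => by
      simpa [hq0, hq0'] using hlim i 1 h1
    refine ⟨(ae_restrict_iff' measurableSet_Ioo).2 (Eventually.of_forall fun x hx => ?_),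
      eq_of_nodeShift_eq hξ01 (hshift 0) (hshift 1)⟩
    refine eqOn_of_eqOn_integral hq.continuousOn hq'.continuousOn (fun x hx => ?_)
      ⟨hx.1.le, hx.2.le⟩
    have := hlim 0 x hx
    rw [hshift 0] at this
    linarith
  · have hg : ∀ x ∈ Icc (0 : ℝ) 1, HasDerivWithinAt
        (fun x => x * nodeShift H γ ξ 0 + (∫ t in (0 : ℝ)..x, q t) / 2)
        (nodeShift H γ ξ 0 + q x / 2) (Icc 0 1) x := fun x hx => by
      have h := ((hasDerivAt_id x).mul_const (nodeShift H γ ξ 0)).hasDerivWithinAt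
        (s := Icc (0 : ℝ) 1)
      rw [one_mul] at h
      exact h.add ((hasDerivWithinAt_integral hq.continuousOn hx).div_const 2)
    refine ⟨fun x => x * nodeShift H γ ξ 0 + (∫ t in (0 : ℝ)..x, q t) / 2, fun x hx => ⟨?_, ?_⟩,
      fun x hx => (hg x hx).differentiableWithinAt, fun x hx => ?_, ?_⟩
    · obtain ⟨j, y, hjy, hyx⟩ := hX₀d x hx
      exact ⟨fun n => j (2 * r * n), fun n => y (2 * r * n), (hsub 0).eventually hjy,
        hyx.comp (hsub 0)⟩
    · rintro j y ⟨hjy, hyx⟩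
      exact tendsto_node hr hq hq0 hξ hξI hΛ 0 hx (hjy.mono fun n hn => hX₀ hn) hyx
    · rw [(hg x hx).derivWithin (uniqueDiffWithinAt_Icc01 hx)]
      simp only
      rw [hq0]
      ring
    · simp only
      rw [hq0, nodeShift_zero]
      ring
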